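/- Let $\Theta\subseteq\mathcal D\subseteq\mathbb R^d$ with $\Theta$ closed and convex and $\mathcal D$ open, let $\|\cdot\|$ be the Euclidean norm and $\mathrm{Proj}_\Theta$ the Euclidean projection onto $\Theta$. Let $\xi$ be a random variable with law $\nu$ and let $F(x,\xi)$, $x\in\mathcal D$, be real-valued and integrable for every $x\in\mathcal D$. Put $f(x)=\mathbb E[F(x,\xi)]$, and assume that $f$ is convex on $\Theta$, that $x_*\in\arg\min_{x\in\Theta}f(x)$, and that, for some $L>0$, almost surely $x\mapsto F(x,\xi)$ is $L$-Lipschitz on $\mathcal D$. Let $x_1\in\mathcal D$, $\gamma_0>0$, $\delta>0$ and let $T\ge1$ be an integer. Put $\ell_T(\delta)=\max\{1,\log(\log_2(2T)/\delta)\}$ and $\gamma_k=\gamma_0 2^k$. Algorithm 2 starts from $x_1$ and $k_0=1$ and, for $t=1,\dots,T$, does the following: - it receives a stochastic subgradient $g_t\in\partial F(x_t,\xi_t)$; - it sets $h_t=L\sqrt{T\,\ell_T\big(\delta/(1+k_{t-1})^2\big)}$ and $x_t^+(k)=\mathrm{Proj}_\Theta\big(x_t-\tfrac{\gamma_k}{h_t}g_t\big)$;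 - it sets $k_t=\min\{k\ge k_{t-1}:\ \|x_t^+(k)-x_1\|\le 38\gamma_k\}$ and $x_{t+1}=x_t^+(k_t)$. Here the $\xi_t$ are i.i.d. with law $\nu$ and the $g_t$ are non-anticipating: for some filtration $(\mathcal F_t)_{t\ge0}$, both $\xi_t$ and $g_t$ are $\mathcal F_t$-measurable, and $\xi_t$ is independent of $\mathcal F_{t-1}$. The relation $g_t\in\partial F(x_t,\xi_t)$ holds almost surely and means that $F(y,\xi_t)\ge F(x_t,\xi_t)+\langle g_t,y-x_t\rangle$ for all $y\in\Theta$ and for all $y$ in some neighbourhood of $x_t$ (in particular, this is the case if the inequality holds for all $y\in\mathcal D$). Let $D_{\gamma_0}=\max\{\|x_1-x_*\|,\gamma_0\}$. Then, with probability at least $1-\delta$, $$\sum_{t=1}^T\big(f(x_t)-f(x_*)\big)\ \le\ 3500\,D_{\gamma_0}L\sqrt T\,\log_2\!\Big(\frac{2D_{\gamma_0}}{\gamma_0}\Big)\,\ell_T^{1/2}\!\left(\frac{\delta}{\log_2^2(4D_{\gamma_0}/\gamma_0)}\right).$$ -/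

import Mathlib

open MeasureTheory ProbabilityTheory

open scoped NNReal

/-- The Euclidean projection of `z` onto `Θ`: the point of `Θ` nearest to `z`. It exists and is
unique when `Θ` is closed, convex and nonempty (otherwise the value is irrelevant). -/
noncomputable def euclideanProj {d : ℕ} (Θ : Set (EuclideanSpace ℝ (Fin d)))
    (z : EuclideanSpace ℝ (Fin d)) : EuclideanSpace ℝ (Fin d) :=
  Classical.epsilon fun y => y ∈ Θ ∧ ∀ w ∈ Θ, ‖z - y‖ ≤ ‖z - w‖

/-- Subgradients at `x` of a function `φ` that is minimised over `Θ`: the affine minorant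
`φ x + ⟪v, y - x⟫` is below `φ y` for all `y ∈ Θ` and all `y` in a full neighbourhood of `x`.
For `φ` defined on an open set `𝒟 ⊇ Θ` this contains the subdifferential of `φ` on `𝒟`, and it
coincides with it when `φ` is convex on a convex `𝒟`. -/
def subdiff {d : ℕ} (Θ : Set (EuclideanSpace ℝ (Fin d))) (φ : EuclideanSpace ℝ (Fin d) → ℝ)
    (x : EuclideanSpace ℝ (Fin d)) : Set (EuclideanSpace ℝ (Fin d)) :=
  {v | (∀ y ∈ Θ, φ x + inner ℝ v (y - x) ≤ φ y) ∧
    ∀ᶠ y in nhds x, φ x + inner ℝ v (y - x) ≤ φ y}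

/-- The objective `f x = 𝔼[F(x, ξ)]`, where `ξ` has law `ν`. -/
noncomputable def expectedObjective {d : ℕ} {Ξ : Type*} [MeasurableSpace Ξ]
    (F : EuclideanSpace ℝ (Fin d) → Ξ → ℝ) (ν : Measure Ξ) (x : EuclideanSpace ℝ (Fin d)) : ℝ :=
  ∫ s, F x s ∂ν

/-- `ℓ_T(δ) = 1 ∨ log (log₂ (2T) / δ)`. -/
noncomputable def ell (T : ℕ) (δ : ℝ) : ℝ :=
  max 1 (Real.log (Real.logb 2 (2 * (T : ℝ)) / δ))

/-- `γ_k = γ₀ 2^k`. -/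
noncomputable def gammaSeq (γ₀ : ℝ) (k : ℕ) : ℝ := γ₀ * 2 ^ k

/-- `h_t = L √(T ℓ_T(δ / (1 + k_{t-1})²))`, as a function of `j = k_{t-1}`. -/
noncomputable def hSeq (L : ℝ) (T : ℕ) (δ : ℝ) (j : ℕ) : ℝ :=
  L * √((T : ℝ) * ell T (δ / (1 + (j : ℝ)) ^ 2))

/-- The probing step `x_t⁺(k) = Proj_Θ(x_t - (γ_k / h_t) g_t)`, with `x = x_t`, `j = k_{t-1}` and
`v = g_t`. -/
noncomputable def probe {d : ℕ} (Θ : Set (EuclideanSpace ℝ (Fin d))) (γ₀ L : ℝ) (T : ℕ) (δ : ℝ)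
    (x : EuclideanSpace ℝ (Fin d)) (j : ℕ) (v : EuclideanSpace ℝ (Fin d)) (k : ℕ) :
    EuclideanSpace ℝ (Fin d) :=
  euclideanProj Θ (x - (gammaSeq γ₀ k / hSeq L T δ j) • v)

/-- The step-size index `k_t = min {k ≥ k_{t-1} : ‖x_t⁺(k) - x₁‖ ≤ 38 γ_k}`. (The minimum exists
as soon as `‖g_t‖ ≤ L`.) -/
noncomputable def nextIndex {d : ℕ} (Θ : Set (EuclideanSpace ℝ (Fin d)))
    (x₁ : EuclideanSpace ℝ (Fin d)) (γ₀ L : ℝ) (T : ℕ) (δ : ℝ)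
    (x : EuclideanSpace ℝ (Fin d)) (j : ℕ) (v : EuclideanSpace ℝ (Fin d)) : ℕ :=
  sInf {k : ℕ | j ≤ k ∧ ‖probe Θ γ₀ L T δ x j v k - x₁‖ ≤ 38 * gammaSeq γ₀ k}

/-- The state `(x_{t+1}, k_t)` of the algorithm after `t` rounds, when it receives the gradients
`g 1, g 2, …`; initially `(x₁, k₀) = (x₁, 1)`. -/
noncomputable def algState {d : ℕ} (Θ : Set (EuclideanSpace ℝ (Fin d)))
    (x₁ : EuclideanSpace ℝ (Fin d)) (γ₀ L : ℝ) (T : ℕ) (δ : ℝ)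
    (g : ℕ → EuclideanSpace ℝ (Fin d)) : ℕ → EuclideanSpace ℝ (Fin d) × ℕ
  | 0 => (x₁, 1)
  | t + 1 =>
    let x := (algState Θ x₁ γ₀ L T δ g t).1
    let j := (algState Θ x₁ γ₀ L T δ g t).2
    let k := nextIndex Θ x₁ γ₀ L T δ x j (g (t + 1))
    (probe Θ γ₀ L T δ x j (g (t + 1)) k, k)

/-- The iterate `x_t`, for `t ≥ 1`; it depends on `g 1, …, g (t - 1)` only. -/
noncomputable def algIterate {d : ℕ} (Θ : Set (EuclideanSpace ℝ (Fin d)))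
    (x₁ : EuclideanSpace ℝ (Fin d)) (γ₀ L : ℝ) (T : ℕ) (δ : ℝ)
    (g : ℕ → EuclideanSpace ℝ (Fin d)) (t : ℕ) : EuclideanSpace ℝ (Fin d) :=
  (algState Θ x₁ γ₀ L T δ g (t - 1)).1

/-!
The step-size index is doubled only when a probing step leaves the ball of radius `38 γ_k` around
the initial point. Let `D = max ‖x₁ - xs‖ γ₀`, and let `K` be the least index at least `1` with
`D ≤ γ_K`, so that `γ_K ≤ 2 D` and `K ≤ log₂ (2 D / γ₀)`.

*Index bound.* While the index equals `K` the step size is constant, `η = γ_K / h_K`. The one-step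
inequality of projected subgradient descent (`norm_probe_sub_sq_le`) then shows that the squared
distance to the minimiser `xs` grows by at most `T η² L² ≤ γ_K²` plus `2 η` times the noise, where
the noise is the sum of the martingale differences `F(x_t, ξ_t) - F(xs, ξ_t) - (f(x_t) - f(xs))`
with changed sign. If the noise is at most `56 γ_K h_K` at all times, the probe with `γ_K` is never
rejected and the index never exceeds `K` (`index_le_of_noise_le`).

*Regret.* For each value of the index the linearised regret telescopes. Since the iterates stay in
a ball of radius `38 γ_k`, the telescoped difference of squared distances is of the order `γ_k D`
although the distances may be much larger than `γ_k`, so each index value contributes a multiple of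
`D h_k` (`sum_inner_le`). There are at most `K` values, which gives the logarithmic factor.

*Noise.* Two sums of martingale differences have to be controlled: over the rounds in which the
index is `K` (uniformly in time), and over the other rounds. Membership in either class depends on
the past only and forces a bounded distance to `xs`, so that Hoeffding's lemma
(`lintegral_exp_noise_le`) and a maximal Azuma–Hoeffding inequality (`measure_exists_le_sum_le`)
apply. The index `K` is deterministic, so no union bound over the indices is needed. The step sizes
themselves depend on the current gradient, which does no harm because they do not enter the sums.

The random function is only assumed to be a.e.-measurable at each point and almost surely
Lipschitz; `exists_measurable_lipschitz_version` replaces it by a jointly measurable version, to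
which Fubini's theorem applies.
-/

/-! ### The Euclidean projection -/

section Projection

variable {d : ℕ} {Θ : Set (EuclideanSpace ℝ (Fin d))}

lemma euclideanProj_spec (hΘ : IsClosed Θ) (hconv : Convex ℝ Θ) (hne : Θ.Nonempty)
    (z : EuclideanSpace ℝ (Fin d)) :
    euclideanProj Θ z ∈ Θ ∧ ∀ w ∈ Θ, ‖z - euclideanProj Θ z‖ ≤ ‖z - w‖ := by
  obtain ⟨v, hv, h⟩ := exists_norm_eq_iInf_of_complete_convex hne hΘ.isComplete hconv z
  refine Classical.epsilon_spec
    (p := fun y => y ∈ Θ ∧ ∀ w ∈ Θ, ‖z - y‖ ≤ ‖z - w‖) ⟨v, hv, fun w hw => ?_⟩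
  rw [h]
  exact ciInf_le ⟨0, Set.forall_mem_range.2 fun _ => norm_nonneg _⟩ (⟨w, hw⟩ : Θ)

lemma inner_sub_euclideanProj_nonpos (hΘ : IsClosed Θ) (hconv : Convex ℝ Θ)
    (z : EuclideanSpace ℝ (Fin d)) {w : EuclideanSpace ℝ (Fin d)} (hw : w ∈ Θ) :
    inner ℝ (z - euclideanProj Θ z) (w - euclideanProj Θ z) ≤ 0 := by
  obtain ⟨hm, hle⟩ := euclideanProj_spec hΘ hconv ⟨w, hw⟩ z
  refine (norm_eq_iInf_iff_real_inner_le_zero hconv hm).1 (le_antisymm ?_ ?_) w hw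
  · have : Nonempty Θ := ⟨⟨w, hw⟩⟩
    exact le_ciInf fun v => hle v v.2
  · exact ciInf_le ⟨0, Set.forall_mem_range.2 fun _ => norm_nonneg _⟩
      (⟨euclideanProj Θ z, hm⟩ : Θ)

lemma norm_euclideanProj_sub_le (hΘ : IsClosed Θ) (hconv : Convex ℝ Θ)
    (z : EuclideanSpace ℝ (Fin d)) {w : EuclideanSpace ℝ (Fin d)} (hw : w ∈ Θ) :
    ‖euclideanProj Θ z - w‖ ≤ ‖z - w‖ := by
  have h := inner_sub_euclideanProj_nonpos hΘ hconv z hw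
  set p := euclideanProj Θ z
  have h1 : ‖z - w‖ ^ 2 = ‖z - p‖ ^ 2 + 2 * inner ℝ (z - p) (p - w) + ‖p - w‖ ^ 2 := by
    rw [← norm_add_sq_real, sub_add_sub_cancel]
  have h2 : inner ℝ (z - p) (p - w) = - inner ℝ (z - p) (w - p) := by
    rw [← inner_neg_right, neg_sub]
  refine le_of_sq_le_sq ?_ (norm_nonneg _)
  nlinarith [sq_nonneg ‖z - p‖]

lemma lipschitzWith_euclideanProj (hΘ : IsClosed Θ) (hconv : Convex ℝ Θ) (hne : Θ.Nonempty) :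
    LipschitzWith 1 (euclideanProj Θ) := by
  refine LipschitzWith.of_dist_le_mul fun a b => ?_
  have ha := inner_sub_euclideanProj_nonpos hΘ hconv a (euclideanProj_spec hΘ hconv hne b).1
  have hb := inner_sub_euclideanProj_nonpos hΘ hconv b (euclideanProj_spec hΘ hconv hne a).1
  set p := euclideanProj Θ a
  set q := euclideanProj Θ b
  rw [dist_eq_norm, dist_eq_norm, NNReal.coe_one, one_mul]
  have h1 : inner ℝ (a - b) (p - q) =
      - inner ℝ (a - p) (q - p) - inner ℝ (b - q) (p - q) + inner ℝ (p - q) (p - q) := by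
    rw [← inner_neg_right, neg_sub, ← inner_sub_left, ← inner_add_left]
    congr 1
    abel
  have h2 := real_inner_le_norm (a - b) (p - q)
  rw [real_inner_self_eq_norm_sq] at h1
  by_contra hlt
  push Not at hlt
  have h3 : 0 < ‖p - q‖ := (norm_nonneg _).trans_lt hlt
  nlinarith

end Projection

/-! ### Subgradients of Lipschitz functions -/

lemma norm_le_of_mem_subdiff {d : ℕ} {Θ 𝒟 : Set (EuclideanSpace ℝ (Fin d))} (h𝒟 : IsOpen 𝒟)
    {φ : EuclideanSpace ℝ (Fin d) → ℝ} {L : ℝ≥0} (hφ : LipschitzOnWith L φ 𝒟)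
    {x v : EuclideanSpace ℝ (Fin d)} (hx : x ∈ 𝒟) (hv : v ∈ subdiff Θ φ x) : ‖v‖ ≤ L := by
  have hc : Filter.Tendsto (fun r : ℝ => x + r • v) (nhdsWithin 0 (Set.Ioi 0)) (nhds x) := by
    have : Continuous fun r : ℝ => x + r • v := by fun_prop
    simpa using (this.tendsto 0).mono_left nhdsWithin_le_nhds
  obtain ⟨r, ⟨hr, hr𝒟⟩, hr0⟩ := (((hc.eventually hv.2).and
    (hc.eventually (h𝒟.mem_nhds hx))).and self_mem_nhdsWithin).exists
  replace hr0 : 0 < r := hr0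
  have h1 : φ (x + r • v) - φ x ≤ L * (r * ‖v‖) := by
    have h := hφ.dist_le_mul _ hr𝒟 _ hx
    rw [Real.dist_eq, dist_eq_norm, add_sub_cancel_left, norm_smul, Real.norm_of_nonneg hr0.le] at h
    exact (le_abs_self _).trans h
  rw [add_sub_cancel_left, inner_smul_right, real_inner_self_eq_norm_sq] at hr
  by_contra hlt
  push Not at hlt
  have h2 : (0 : ℝ) < ‖v‖ := L.2.trans_lt hlt
  have h3 : 0 < r * ‖v‖ := by positivity
  nlinarith

/-! ### The parameters of the algorithm -/

lemma one_le_ell (T : ℕ) (δ : ℝ) : 1 ≤ ell T δ := le_max_left _ _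

lemma one_le_logb_two_mul {T : ℕ} (hT : 1 ≤ T) : 1 ≤ Real.logb 2 (2 * (T : ℝ)) := by
  rw [Real.le_logb_iff_rpow_le (by norm_num) (by positivity)]
  have : (1 : ℝ) ≤ T := by exact_mod_cast hT
  simpa using this

lemma ell_le_ell {T : ℕ} (hT : 1 ≤ T) {δ δ' : ℝ} (hδ : 0 < δ) (h : δ ≤ δ') :
    ell T δ' ≤ ell T δ := by
  have h1 := one_le_logb_two_mul hT
  have h2 : 0 < δ' := hδ.trans_le h
  refine max_le_max le_rfl (Real.log_le_log (by positivity) ?_)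
  gcongr

lemma hSeq_le_hSeq {L : ℝ} (hL : 0 ≤ L) {T : ℕ} (hT : 1 ≤ T) {δ : ℝ} (hδ : 0 < δ) {j k : ℕ}
    (h : j ≤ k) : hSeq L T δ j ≤ hSeq L T δ k := by
  have : ell T (δ / (1 + (j : ℝ)) ^ 2) ≤ ell T (δ / (1 + (k : ℝ)) ^ 2) :=
    ell_le_ell hT (by positivity) (by gcongr)
  unfold hSeq
  gcongr

lemma mul_sqrt_le_hSeq {L : ℝ} (hL : 0 ≤ L) (T : ℕ) (δ : ℝ) (j : ℕ) :
    L * √(T : ℝ) ≤ hSeq L T δ j := by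
  unfold hSeq
  gcongr
  exact le_mul_of_one_le_right (by positivity) (one_le_ell _ _)

lemma le_hSeq {L : ℝ} (hL : 0 ≤ L) {T : ℕ} (hT : 1 ≤ T) (δ : ℝ) (j : ℕ) : L ≤ hSeq L T δ j := by
  refine le_trans ?_ (mul_sqrt_le_hSeq hL T δ j)
  refine le_mul_of_one_le_right hL ?_
  rw [Real.one_le_sqrt]
  exact_mod_cast hT

lemma gammaSeq_pos {γ₀ : ℝ} (h : 0 < γ₀) (k : ℕ) : 0 < gammaSeq γ₀ k := by
  unfold gammaSeq; positivity

lemma gammaSeq_succ (γ₀ : ℝ) (k : ℕ) : gammaSeq γ₀ (k + 1) = 2 * gammaSeq γ₀ k := by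
  unfold gammaSeq; ring

lemma gammaSeq_mono {γ₀ : ℝ} (h : 0 < γ₀) : Monotone (gammaSeq γ₀) := by
  refine monotone_nat_of_le_succ fun k => ?_
  rw [gammaSeq_succ]
  linarith [gammaSeq_pos h k]

lemma two_mul_gammaSeq_le {γ₀ : ℝ} (h : 0 < γ₀) {j k : ℕ} (hjk : j < k) :
    2 * gammaSeq γ₀ j ≤ gammaSeq γ₀ k := by
  rw [← gammaSeq_succ]
  exact gammaSeq_mono h hjk

/-! ### One step of the algorithm -/

section Step

variable {d : ℕ} {Θ : Set (EuclideanSpace ℝ (Fin d))} {γ₀ L : ℝ} {T : ℕ} {δ : ℝ}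
  {x₁ xs x v : EuclideanSpace ℝ (Fin d)} {j k : ℕ}

lemma norm_probe_sub_le (hΘ : IsClosed Θ) (hconv : Convex ℝ Θ) (hxs : xs ∈ Θ) (hγ₀ : 0 < γ₀)
    (hL : 0 < L) (hT : 1 ≤ T) (hv : ‖v‖ ≤ L) :
    ‖probe Θ γ₀ L T δ x j v k - xs‖ ≤ ‖x - xs‖ + gammaSeq γ₀ k := by
  have hh := le_hSeq hL.le hT δ j
  have hγ := gammaSeq_pos hγ₀ k
  have hh0 := hL.trans_le hh
  refine (norm_euclideanProj_sub_le hΘ hconv _ hxs).trans ?_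
  rw [sub_right_comm]
  refine (norm_sub_le _ _).trans (add_le_add le_rfl ?_)
  rw [norm_smul, Real.norm_of_nonneg (by positivity), div_mul_eq_mul_div, div_le_iff₀ hh0]
  gcongr
  exact hv.trans hh

/-- The one-step inequality of projected subgradient descent. -/
lemma norm_probe_sub_sq_le (hΘ : IsClosed Θ) (hconv : Convex ℝ Θ) (hxs : xs ∈ Θ)
    (hv : ‖v‖ ≤ L) :
    ‖probe Θ γ₀ L T δ x j v k - xs‖ ^ 2 ≤ ‖x - xs‖ ^ 2
      - 2 * (gammaSeq γ₀ k / hSeq L T δ j) * inner ℝ v (x - xs)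
      + (gammaSeq γ₀ k / hSeq L T δ j) ^ 2 * L ^ 2 := by
  set η := gammaSeq γ₀ k / hSeq L T δ j
  have h : ‖probe Θ γ₀ L T δ x j v k - xs‖ ≤ ‖x - η • v - xs‖ :=
    norm_euclideanProj_sub_le hΘ hconv _ hxs
  rw [sub_right_comm] at h
  have h2 := pow_le_pow_left₀ (norm_nonneg _) h 2
  rw [norm_sub_sq_real (x - xs), inner_smul_right, norm_smul, mul_pow, Real.norm_eq_abs, sq_abs,
    real_inner_comm] at h2
  have h3 : ‖v‖ ^ 2 ≤ L ^ 2 := by gcongr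
  nlinarith [sq_nonneg η]

lemma nextIndex_spec (hjk : j ≤ k)
    (hk : ‖probe Θ γ₀ L T δ x j v k - x₁‖ ≤ 38 * gammaSeq γ₀ k) :
    nextIndex Θ x₁ γ₀ L T δ x j v ≤ k ∧ j ≤ nextIndex Θ x₁ γ₀ L T δ x j v ∧
      ‖probe Θ γ₀ L T δ x j v (nextIndex Θ x₁ γ₀ L T δ x j v) - x₁‖ ≤
        38 * gammaSeq γ₀ (nextIndex Θ x₁ γ₀ L T δ x j v) :=
  ⟨Nat.sInf_le ⟨hjk, hk⟩, Nat.sInf_mem (s := {k : ℕ | j ≤ k ∧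
    ‖probe Θ γ₀ L T δ x j v k - x₁‖ ≤ 38 * gammaSeq γ₀ k}) ⟨k, hjk, hk⟩⟩

end Step

lemma algState_fst_mem {d : ℕ} {Θ : Set (EuclideanSpace ℝ (Fin d))} (hΘ : IsClosed Θ)
    (hconv : Convex ℝ Θ) (hne : Θ.Nonempty) (x₁ : EuclideanSpace ℝ (Fin d)) (γ₀ L : ℝ) (T : ℕ)
    (δ : ℝ) (g : ℕ → EuclideanSpace ℝ (Fin d)) {t : ℕ} (ht : t ≠ 0) :
    (algState Θ x₁ γ₀ L T δ g t).1 ∈ Θ := by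
  obtain ⟨t, rfl⟩ := Nat.exists_eq_succ_of_ne_zero ht
  exact (euclideanProj_spec hΘ hconv hne _).1

/-! ### The step-size index stays below the target index -/

section Path

variable {d : ℕ} {Θ : Set (EuclideanSpace ℝ (Fin d))} {x₁ xs : EuclideanSpace ℝ (Fin d)}
  {γ₀ L : ℝ} {T : ℕ} {δ : ℝ}

/-- The states in which the target index `K` has been reached, cut off at distance `39 γ_K` from
the minimiser (a distance that is not exceeded as long as the index is at most `K`). Initial
points outside `Θ` are left out, since there the objective may lie below its minimum over `Θ`. -/
def targetStates (Θ : Set (EuclideanSpace ℝ (Fin d))) (xs : EuclideanSpace ℝ (Fin d)) (γ₀ : ℝ)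
    (K : ℕ) : Set (EuclideanSpace ℝ (Fin d) × ℕ) :=
  {p | (p.2 = K ∧ p.1 ∈ Θ) ∧ ‖p.1 - xs‖ ≤ 39 * gammaSeq γ₀ K}

/-- The states, within the same distance, that are not in `targetStates`. -/
def earlyStates (Θ : Set (EuclideanSpace ℝ (Fin d))) (xs : EuclideanSpace ℝ (Fin d)) (γ₀ : ℝ)
    (K : ℕ) : Set (EuclideanSpace ℝ (Fin d) × ℕ) :=
  {p | ¬(p.2 = K ∧ p.1 ∈ Θ) ∧ ‖p.1 - xs‖ ≤ 39 * gammaSeq γ₀ K}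

open scoped Classical in
/-- If `γ_K` is at least the distance from `x₁` to the minimiser, and the noise `Δ` accumulated
while the index equals `K` is of the order `γ_K h_K`, then the index never exceeds `K`: as long as
it equals `K`, the squared distance to the minimiser grows by a bounded multiple of `γ_K ^ 2`
only, so that the probing step with `γ_K` is accepted. Here `a` stands for the suboptimality of
the iterates. -/
theorem index_le_of_noise_le (hΘ : IsClosed Θ) (hconv : Convex ℝ Θ) (hxs : xs ∈ Θ)
    (hγ₀ : 0 < γ₀) (hL : 0 < L) (hT : 1 ≤ T) {K : ℕ} (hK : 1 ≤ K)
    (hxK : ‖x₁ - xs‖ ≤ gammaSeq γ₀ K) {g : ℕ → EuclideanSpace ℝ (Fin d)}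
    (hg : ∀ t < T, ‖g (t + 1)‖ ≤ L) {a Δ : ℕ → ℝ}
    (ha : ∀ t < T, (algState Θ x₁ γ₀ L T δ g t).1 ∈ Θ → 0 ≤ a t)
    (haΔ : ∀ t < T, a t + Δ t ≤ inner ℝ (g (t + 1)) ((algState Θ x₁ γ₀ L T δ g t).1 - xs))
    (hS : ∀ t ≤ T, -(∑ s ∈ Finset.range t,
      if algState Θ x₁ γ₀ L T δ g s ∈ targetStates Θ xs γ₀ K then Δ s else 0) ≤
        56 * gammaSeq γ₀ K * hSeq L T δ K) :
    (∀ t ≤ T, (algState Θ x₁ γ₀ L T δ g t).2 ≤ K ∧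
      ‖(algState Θ x₁ γ₀ L T δ g t).1 - x₁‖ ≤
        38 * gammaSeq γ₀ (algState Θ x₁ γ₀ L T δ g t).2) ∧
    ∀ t < T, (algState Θ x₁ γ₀ L T δ g t).2 ≤ (algState Θ x₁ γ₀ L T δ g (t + 1)).2 := by
  set x : ℕ → EuclideanSpace ℝ (Fin d) := fun t => (algState Θ x₁ γ₀ L T δ g t).1 with hx
  set k : ℕ → ℕ := fun t => (algState Θ x₁ γ₀ L T δ g t).2 with hk
  set γ := gammaSeq γ₀ K with hγ
  set h := hSeq L T δ K with hh
  set S : ℕ → ℝ := fun t => ∑ s ∈ Finset.range t,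
    if algState Θ x₁ γ₀ L T δ g s ∈ targetStates Θ xs γ₀ K then Δ s else 0 with hSdef
  have hγ0 : 0 < γ := gammaSeq_pos hγ₀ K
  have hLh : L ≤ h := le_hSeq hL.le hT δ K
  have hh0 : 0 < h := hL.trans_le hLh
  set η := γ / h with hη
  have hη0 : 0 < η := by positivity
  -- after at most `T` steps the sum of the squared step lengths is at most `γ ^ 2`
  have hηL : ∀ t : ℕ, t ≤ T → t * (η ^ 2 * L ^ 2) ≤ γ ^ 2 := by
    intro t ht
    have h1 := mul_sqrt_le_hSeq hL.le T δ K
    have h2 : (L * √(T : ℝ)) ^ 2 ≤ h ^ 2 := by gcongr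
    rw [mul_pow, Real.sq_sqrt (by positivity)] at h2
    have h3 : (t : ℝ) ≤ T := by exact_mod_cast ht
    have h4 : (t : ℝ) * L ^ 2 ≤ h ^ 2 := by nlinarith [sq_nonneg L]
    calc t * (η ^ 2 * L ^ 2) = γ ^ 2 * (t * L ^ 2) / h ^ 2 := by rw [hη]; field_simp
      _ ≤ γ ^ 2 * h ^ 2 / h ^ 2 := by gcongr
      _ = γ ^ 2 := by field_simp
  have hηS : ∀ t ≤ T, -(2 * η * S t) ≤ 112 * γ ^ 2 := by
    intro t ht
    calc -(2 * η * S t) = 2 * η * (-S t) := by ring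
      _ ≤ 2 * η * (56 * γ * h) := by
        gcongr
        exact hS t ht
      _ = 112 * γ ^ 2 := by rw [hη]; field_simp; ring
  -- the first step in which the index is `K` starts within `20 γ` of the minimiser and ends within
  -- `21 γ`, whence the constant `441 = 21 ^ 2`
  suffices H : ∀ t ≤ T, k t ≤ K ∧ ‖x t - x₁‖ ≤ 38 * gammaSeq γ₀ (k t) ∧
      (k t < K ∨ t = 0 → S t = 0) ∧
      ‖x t - xs‖ ^ 2 ≤ 441 * γ ^ 2 + t * (η ^ 2 * L ^ 2) - 2 * η * S t ∧
      ∀ s < t, k s ≤ k (s + 1) from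
    ⟨fun t ht => ⟨(H t ht).1, (H t ht).2.1⟩, fun t ht => (H T le_rfl).2.2.2.2 t ht⟩
  intro t
  induction t with
  | zero =>
    intro _
    have h1 : ‖x 0 - xs‖ ≤ γ := hxK
    have h2 : S 0 = 0 := Finset.sum_range_zero _
    refine ⟨hK, ?_, fun _ => h2, ?_, by simp⟩
    · have := gammaSeq_pos hγ₀ (k 0)
      simp only [hx, algState, sub_self, norm_zero]
      positivity
    · rw [h2, Nat.cast_zero]
      nlinarith [norm_nonneg (x 0 - xs)]
  | succ t ih =>
    intro ht
    obtain ⟨ihK, ihx, ihS, ihsq, ihmono⟩ := ih (by omega)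
    have hgt := hg t (by omega)
    set I := algState Θ x₁ γ₀ L T δ g t ∈ targetStates Θ xs γ₀ K with hI
    have hSs : S (t + 1) = S t + if I then Δ t else 0 := Finset.sum_range_succ _ _
    have hkγ : gammaSeq γ₀ (k t) ≤ γ := gammaSeq_mono hγ₀ ihK
    have hdist : ‖x t - xs‖ ≤ 39 * γ := by
      calc ‖x t - xs‖ ≤ ‖x t - x₁‖ + ‖x₁ - xs‖ := norm_sub_le_norm_sub_add_norm_sub _ _ _
        _ ≤ 39 * γ := by linarith
    have hearly : k t < K ∨ t = 0 → ‖x t - xs‖ ≤ 20 * γ := by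
      intro hor
      have h1 : ‖x t - x₁‖ ≤ 19 * γ := by
        rcases hor with h1 | h1
        · linarith [two_mul_gammaSeq_le hγ₀ h1]
        · subst h1
          simp only [hx, algState, sub_self, norm_zero]
          positivity
      calc ‖x t - xs‖ ≤ ‖x t - x₁‖ + ‖x₁ - xs‖ := norm_sub_le_norm_sub_add_norm_sub _ _ _
        _ ≤ 20 * γ := by linarith
    have hnI : ¬ I → k t < K ∨ t = 0 := by
      intro hn
      by_contra! hcon
      exact hn ⟨⟨le_antisymm ihK hcon.1, algState_fst_mem hΘ hconv ⟨xs, hxs⟩ x₁ γ₀ L T δ g hcon.2⟩,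
        hdist⟩
    -- the probing step with the target index
    set y := probe Θ γ₀ L T δ (x t) (k t) (g (t + 1)) K
    have hysq : ‖y - xs‖ ^ 2 ≤
        441 * γ ^ 2 + (t + 1 : ℕ) * (η ^ 2 * L ^ 2) - 2 * η * S (t + 1) := by
      by_cases hIt : I
      · have h1 : k t = K := hIt.1.1
        have h2 := norm_probe_sub_sq_le (γ₀ := γ₀) (T := T) (δ := δ) (x := x t) (j := k t) (k := K)
          hΘ hconv hxs hgt
        rw [show probe Θ γ₀ L T δ (x t) (k t) (g (t + 1)) K = y from rfl, h1, ← hγ, ← hh, ← hη] at h2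
        have h3 := haΔ t (by omega)
        have h4 := ha t (by omega) hIt.1.2
        rw [hSs, if_pos hIt]
        have h5 : η * Δ t ≤ η * inner ℝ (g (t + 1)) (x t - xs) := by gcongr; linarith
        push_cast
        nlinarith
      · have h1 := hnI hIt
        have h2 := norm_probe_sub_le (γ₀ := γ₀) (δ := δ) (x := x t) (j := k t) (k := K)
          hΘ hconv hxs hγ₀ hL hT hgt
        have h3 : ‖y - xs‖ ≤ 21 * γ := by linarith [hearly h1]
        have h4 : ‖y - xs‖ ^ 2 ≤ (21 * γ) ^ 2 := by gcongr
        rw [hSs, if_neg hIt, ihS h1]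
        nlinarith [show (0 : ℝ) ≤ (t + 1 : ℕ) * (η ^ 2 * L ^ 2) by positivity]
    have hyx : ‖y - x₁‖ ≤ 38 * γ := by
      have h1 : ‖y - xs‖ ≤ 37 * γ := by
        refine le_of_sq_le_sq ?_ (by positivity)
        nlinarith [hηS (t + 1) ht, hηL (t + 1) ht, sq_nonneg γ]
      calc ‖y - x₁‖ ≤ ‖y - xs‖ + ‖xs - x₁‖ := norm_sub_le_norm_sub_add_norm_sub _ _ _
        _ ≤ 38 * γ := by rw [norm_sub_rev xs]; linarith
    obtain ⟨hn1, hn2, hn3⟩ := nextIndex_spec (x₁ := x₁) ihK hyx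
    change k (t + 1) ≤ K at hn1
    change k t ≤ k (t + 1) at hn2
    change ‖x (t + 1) - x₁‖ ≤ 38 * gammaSeq γ₀ (k (t + 1)) at hn3
    have hS0 : k (t + 1) < K → S (t + 1) = 0 := by
      intro hlt
      have h1 : k t < K := by omega
      rw [hSs, if_neg fun hIt => h1.ne hIt.1.1, ihS (Or.inl h1), add_zero]
    refine ⟨hn1, hn3, fun hor => hS0 (by omega), ?_, ?_⟩
    swap
    · intro s hs
      rcases (Nat.lt_succ_iff.1 hs).lt_or_eq with h1 | rfl
      · exact ihmono s h1
      · exact hn2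
    rcases hn1.lt_or_eq with hlt | heq
    · have h1 : ‖x (t + 1) - xs‖ ≤ 20 * γ := by
        calc ‖x (t + 1) - xs‖ ≤ ‖x (t + 1) - x₁‖ + ‖x₁ - xs‖ :=
              norm_sub_le_norm_sub_add_norm_sub _ _ _
          _ ≤ 20 * γ := by linarith [two_mul_gammaSeq_le hγ₀ hlt]
      have h2 : ‖x (t + 1) - xs‖ ^ 2 ≤ (20 * γ) ^ 2 := by gcongr
      rw [hS0 hlt]
      nlinarith [show (0 : ℝ) ≤ (t + 1 : ℕ) * (η ^ 2 * L ^ 2) by positivity, sq_nonneg γ]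
    · have h1 : x (t + 1) = y := by
        change probe Θ γ₀ L T δ (x t) (k t) (g (t + 1)) (k (t + 1)) = y
        rw [heq]
      rw [h1]
      exact hysq

/-! ### The regret along a path -/

/-- The squared distance to a point at distance `c` from the centre varies over a ball of radius
`38 γ` by at most a multiple of `γ D`: with `y` the distance from a point of the ball,
`y ≥ c - 38 γ`. -/
lemma sq_add_sub_sq_le {c γ D y : ℝ} (hc : 0 ≤ c) (hcD : c ≤ D) (hγ : 0 < γ) (hγD : γ ≤ 2 * D)
    (hcy : c - 38 * γ ≤ y) : (c + 38 * γ) ^ 2 - y ^ 2 ≤ 2 * γ * (1501 * D) := by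
  rcases le_total (38 * γ) c with h | h
  · have : (c - 38 * γ) ^ 2 ≤ y ^ 2 := by
      have : 0 ≤ c - 38 * γ := by linarith
      gcongr
    nlinarith
  · nlinarith [mul_nonneg hγ.le (sub_nonneg.2 hcD), mul_nonneg hγ.le (sub_nonneg.2 hγD),
      mul_nonneg hc (sub_nonneg.2 h), sq_nonneg y]

/-- On a path along which the index stays below `K` and the iterates stay in the balls of radius
`38 γ_k` around `x₁`, the linearised regret is of the order `D H` times the number of
indices: while the index is constant the regret telescopes, and each change of the index costs one
variation of the squared distance over a ball, divided by the step size. -/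
theorem sum_inner_le (hΘ : IsClosed Θ) (hconv : Convex ℝ Θ) (hxs : xs ∈ Θ)
    (hγ₀ : 0 < γ₀) (hL : 0 < L) (hT : 1 ≤ T) {K : ℕ} {D H : ℝ} (hD : ‖x₁ - xs‖ ≤ D)
    (hKD : gammaSeq γ₀ K ≤ 2 * D) (hH : ∀ k ≤ K, hSeq L T δ k ≤ H)
    {g : ℕ → EuclideanSpace ℝ (Fin d)} (hg : ∀ t < T, ‖g (t + 1)‖ ≤ L)
    (hpath : ∀ t ≤ T, (algState Θ x₁ γ₀ L T δ g t).2 ≤ K ∧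
      ‖(algState Θ x₁ γ₀ L T δ g t).1 - x₁‖ ≤
        38 * gammaSeq γ₀ (algState Θ x₁ γ₀ L T δ g t).2)
    (hmono : ∀ t < T, (algState Θ x₁ γ₀ L T δ g t).2 ≤ (algState Θ x₁ γ₀ L T δ g (t + 1)).2) :
    ∑ t ∈ Finset.range T, inner ℝ (g (t + 1)) ((algState Θ x₁ γ₀ L T δ g t).1 - xs) ≤
      1541 * D * H * K := by
  set x : ℕ → EuclideanSpace ℝ (Fin d) := fun t => (algState Θ x₁ γ₀ L T δ g t).1 with hx
  set k : ℕ → ℕ := fun t => (algState Θ x₁ γ₀ L T δ g t).2 with hk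
  set c := ‖x₁ - xs‖ with hc
  have hc0 : 0 ≤ c := norm_nonneg _
  have hγ0 := gammaSeq_pos hγ₀
  have hh0 : ∀ k, 0 < hSeq L T δ k := fun k => hL.trans_le (le_hSeq hL.le hT δ k)
  have hH0 : 0 < H := (hh0 K).trans_le (hH K le_rfl)
  have hLH : L ≤ H := (le_hSeq hL.le hT δ K).trans (hH K le_rfl)
  have hD0 : 0 < D := by linarith [hγ0 K]
  have hT0 : 0 < √(T : ℝ) := Real.sqrt_pos.2 (by exact_mod_cast hT)
  have hball : ∀ t ≤ T, ‖x t - xs‖ ≤ c + 38 * gammaSeq γ₀ (k t) ∧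
      c - 38 * gammaSeq γ₀ (k t) ≤ ‖x t - xs‖ := by
    intro t ht
    have h1 := (hpath t ht).2
    have h2 := norm_sub_le_norm_sub_add_norm_sub (x t) x₁ xs
    have h3 := norm_sub_le_norm_sub_add_norm_sub x₁ (x t) xs
    rw [norm_sub_rev x₁ (x t)] at h3
    constructor <;> linarith
  -- the inverse of twice the step size used while the index is constant
  set w : ℕ → ℝ := fun k => hSeq L T δ k / (2 * gammaSeq γ₀ k) with hw
  have hw0 : ∀ k, 0 < w k := fun k => by have := hγ0 k; have := hh0 k; positivity
  have hgap : ∀ t ≤ T, w (k t) * ((c + 38 * gammaSeq γ₀ (k t)) ^ 2 - ‖x t - xs‖ ^ 2) ≤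
      1501 * D * H := by
    intro t ht
    have hkK := (hpath t ht).1
    have h1 : gammaSeq γ₀ (k t) ≤ 2 * D := (gammaSeq_mono hγ₀ hkK).trans hKD
    have h2 := sq_add_sub_sq_le hc0 hD (hγ0 (k t)) h1 (hball t ht).2
    have h3 := hγ0 (k t)
    calc w (k t) * ((c + 38 * gammaSeq γ₀ (k t)) ^ 2 - ‖x t - xs‖ ^ 2)
        ≤ w (k t) * (2 * gammaSeq γ₀ (k t) * (1501 * D)) := by
          gcongr
          exact (hw0 _).le
      _ = 1501 * D * hSeq L T δ (k t) := by simp only [hw]; field_simp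
      _ ≤ 1501 * D * H := by
          gcongr
          exact hH _ hkK
  -- the potential `w (k t) * ‖x t - xs‖ ^ 2` is compared with its maximum over the current ball,
  -- so that a change of the index costs only the variation bounded by `hgap`
  have main : ∀ t ≤ T, ∑ s ∈ Finset.range t, inner ℝ (g (s + 1)) (x s - xs) +
      w (k t) * ‖x t - xs‖ ^ 2 ≤ 1540 * D * H * ((k t : ℝ) - 1) +
        w (k t) * (c + 38 * gammaSeq γ₀ (k t)) ^ 2 + t * (D * L / √(T : ℝ)) := by
    intro t
    induction t with
    | zero =>
      intro _
      have h1 : k 0 = 1 := rfl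
      rw [Finset.sum_range_zero, h1, Nat.cast_one, Nat.cast_zero]
      have h2 : w 1 * ‖x 0 - xs‖ ^ 2 ≤ w 1 * (c + 38 * gammaSeq γ₀ 1) ^ 2 := by
        have := (hw0 1).le
        gcongr
        exact (hball 0 (by omega)).1
      linarith
    | succ t ih =>
      intro ht
      have ih := ih (by omega)
      have hgt := hg t (by omega)
      rw [Finset.sum_range_succ]
      rcases (hmono t (by omega)).eq_or_lt with heq | hlt
      · change k t = k (t + 1) at heq
        have h1 := norm_probe_sub_sq_le (γ₀ := γ₀) (T := T) (δ := δ) (x := x t) (j := k t)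
          (k := k (t + 1)) hΘ hconv hxs hgt
        change ‖x (t + 1) - xs‖ ^ 2 ≤ _ at h1
        rw [← heq] at h1 ⊢
        have hγt := hγ0 (k t)
        have hht := hh0 (k t)
        have h2 : w (k t) * ‖x (t + 1) - xs‖ ^ 2 ≤ w (k t) * ‖x t - xs‖ ^ 2
            - inner ℝ (g (t + 1)) (x t - xs)
            + gammaSeq γ₀ (k t) * L ^ 2 / (2 * hSeq L T δ (k t)) := by
          calc w (k t) * ‖x (t + 1) - xs‖ ^ 2 ≤ w (k t) * _ :=
                mul_le_mul_of_nonneg_left h1 (hw0 _).le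
            _ = _ := by simp only [hw]; field_simp
        have h3 : gammaSeq γ₀ (k t) * L ^ 2 / (2 * hSeq L T δ (k t)) ≤ D * L / √(T : ℝ) := by
          have h4 : gammaSeq γ₀ (k t) ≤ 2 * D :=
            (gammaSeq_mono hγ₀ (hpath t (by omega)).1).trans hKD
          have h5 := mul_sqrt_le_hSeq hL.le T δ (k t)
          calc gammaSeq γ₀ (k t) * L ^ 2 / (2 * hSeq L T δ (k t))
              ≤ 2 * D * L ^ 2 / (2 * (L * √(T : ℝ))) := by gcongr
            _ = D * L / √(T : ℝ) := by field_simp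
        push_cast
        linarith
      · change k t < k (t + 1) at hlt
        have hkK : k (t + 1) ≤ K := (hpath (t + 1) ht).1
        have h1 : inner ℝ (g (t + 1)) (x t - xs) ≤ 39 * D * H := by
          have h2 : 2 * gammaSeq γ₀ (k t) ≤ gammaSeq γ₀ K :=
            two_mul_gammaSeq_le hγ₀ (hlt.trans_le hkK)
          have h3 := (hball t (by omega)).1
          calc inner ℝ (g (t + 1)) (x t - xs) ≤ ‖g (t + 1)‖ * ‖x t - xs‖ :=
                real_inner_le_norm _ _
            _ ≤ H * (39 * D) := by
                gcongr
                · exact hgt.trans hLH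
                · linarith
            _ = 39 * D * H := by ring
        have h2 : w (k (t + 1)) * ‖x (t + 1) - xs‖ ^ 2 ≤
            w (k (t + 1)) * (c + 38 * gammaSeq γ₀ (k (t + 1))) ^ 2 := by
          have := (hw0 (k (t + 1))).le
          gcongr
          exact (hball (t + 1) ht).1
        have h3 := hgap t (by omega)
        have h4 : ((k t : ℝ) - 1) + 1 ≤ (k (t + 1) : ℝ) - 1 := by
          have : (k t : ℝ) + 1 ≤ k (t + 1) := by exact_mod_cast hlt
          linarith
        have h5 : 1540 * D * H * (((k t : ℝ) - 1) + 1) ≤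
            1540 * D * H * ((k (t + 1) : ℝ) - 1) := by gcongr
        have h6 : (0 : ℝ) ≤ D * L / √(T : ℝ) := by positivity
        push_cast
        linarith
  have h1 := main T le_rfl
  have h2 := hgap T le_rfl
  have h3 : T * (D * L / √(T : ℝ)) ≤ D * H := by
    have h4 : (T : ℝ) = √(T : ℝ) * √(T : ℝ) := (Real.mul_self_sqrt (by positivity)).symm
    have h5 := (mul_sqrt_le_hSeq hL.le T δ K).trans (hH K le_rfl)
    calc T * (D * L / √(T : ℝ)) = D * (L * √(T : ℝ)) := by
          nth_rewrite 1 [h4]; field_simp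
      _ ≤ D * H := by gcongr
  have h4 : 1540 * D * H * (k T : ℝ) ≤ 1540 * D * H * K := by
    have : (k T : ℝ) ≤ K := by exact_mod_cast (hpath T le_rfl).1
    gcongr
  have h5 : 1 ≤ (K : ℝ) := by
    have : 1 ≤ K := (hpath 0 (by omega)).1
    exact_mod_cast this
  have h6 : D * H ≤ D * H * K := le_mul_of_one_le_right (by positivity) h5
  nlinarith [mul_pos hD0 hH0]

end Path

/-! ### Measurability of the algorithm -/

section Measurability

variable {d : ℕ} {Θ : Set (EuclideanSpace ℝ (Fin d))} {x₁ : EuclideanSpace ℝ (Fin d)}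
  {γ₀ L : ℝ} {T : ℕ} {δ : ℝ}

lemma measurable_probe (hΘ : IsClosed Θ) (hconv : Convex ℝ Θ) (hne : Θ.Nonempty) (k : ℕ) :
    Measurable fun p : (EuclideanSpace ℝ (Fin d) × ℕ) × EuclideanSpace ℝ (Fin d) =>
      probe Θ γ₀ L T δ p.1.1 p.1.2 p.2 k := by
  refine (lipschitzWith_euclideanProj hΘ hconv hne).continuous.measurable.comp ?_
  have h : Measurable fun j : ℕ => gammaSeq γ₀ k / hSeq L T δ j := measurable_from_top
  exact measurable_fst.fst.sub ((h.comp measurable_fst.snd).smul measurable_snd)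

lemma measurable_nextIndex (hΘ : IsClosed Θ) (hconv : Convex ℝ Θ) (hne : Θ.Nonempty) :
    Measurable fun p : (EuclideanSpace ℝ (Fin d) × ℕ) × EuclideanSpace ℝ (Fin d) =>
      nextIndex Θ x₁ γ₀ L T δ p.1.1 p.1.2 p.2 := by
  set q : ℕ → Set ((EuclideanSpace ℝ (Fin d) × ℕ) × EuclideanSpace ℝ (Fin d)) := fun k =>
    {p | p.1.2 ≤ k ∧ ‖probe Θ γ₀ L T δ p.1.1 p.1.2 p.2 k - x₁‖ ≤ 38 * gammaSeq γ₀ k} with hq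
  have hqm : ∀ k, MeasurableSet (q k) := fun k =>
    (measurableSet_le measurable_fst.snd measurable_const).inter
      (measurableSet_le ((measurable_probe hΘ hconv hne k).sub_const x₁).norm measurable_const)
  refine measurable_to_countable' fun k => ?_
  -- the index is `k` if `k` is the first admissible one, or if `k = 0` and none is admissible
  have h : (fun p : (EuclideanSpace ℝ (Fin d) × ℕ) × EuclideanSpace ℝ (Fin d) =>
      nextIndex Θ x₁ γ₀ L T δ p.1.1 p.1.2 p.2) ⁻¹' {k} =
      (q k ∩ ⋂ i, ⋂ (_ : i < k), (q i)ᶜ) ∪ ({_p | k = 0} ∩ ⋂ i, (q i)ᶜ) := by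
    ext p
    simp only [Set.mem_preimage, Set.mem_singleton_iff, Set.mem_union, Set.mem_inter_iff,
      Set.mem_iInter, Set.mem_compl_iff, Set.mem_ofPred_eq]
    change sInf {i | p ∈ q i} = k ↔ _
    rcases Set.eq_empty_or_nonempty {i | p ∈ q i} with he | hn
    · have hno : ∀ i, p ∉ q i := fun i hi => by
        have : i ∈ {i | p ∈ q i} := hi
        simp [he] at this
      rw [he, Nat.sInf_empty]
      exact ⟨fun h => Or.inr ⟨h.symm, hno⟩, fun h => h.elim (fun h => absurd h.1 (hno k))
        fun h => h.1.symm⟩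
    · constructor
      · rintro rfl
        exact Or.inl ⟨Nat.sInf_mem hn, fun i hi => Nat.notMem_of_lt_sInf hi⟩
      · rintro (⟨h1, h2⟩ | ⟨-, h2⟩)
        · refine le_antisymm (Nat.sInf_le h1) ?_
          by_contra! hlt
          exact h2 _ hlt (Nat.sInf_mem hn)
        · exact absurd hn.some_mem (h2 _)
  rw [h]
  exact ((hqm k).inter (.iInter fun i => .iInter fun _ => (hqm i).compl)).union
    ((MeasurableSet.const _).inter (.iInter fun i => (hqm i).compl))

/-- The state after `t` rounds is a measurable function of the first `t` gradients. -/
lemma measurable_algState {Ω : Type*} {mΩ : MeasurableSpace Ω} (hΘ : IsClosed Θ)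
    (hconv : Convex ℝ Θ) (hne : Θ.Nonempty) {𝓕 : Filtration ℕ mΩ}
    {g : ℕ → Ω → EuclideanSpace ℝ (Fin d)}
    (hg : ∀ t ∈ Finset.Icc 1 T, Measurable[𝓕 t] (g t)) :
    ∀ t ≤ T, Measurable[𝓕 t] fun ω => algState Θ x₁ γ₀ L T δ (fun s => g s ω) t := by
  intro t
  induction t with
  | zero => exact fun _ => measurable_const
  | succ t ih =>
    intro ht
    have h1 := (ih (by omega)).mono (𝓕.mono (Nat.le_succ t)) le_rfl
    have h2 := h1.prodMk (hg (t + 1) (Finset.mem_Icc.2 ⟨by omega, ht⟩))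
    have h3 := (measurable_nextIndex (x₁ := x₁) (γ₀ := γ₀) (L := L) (T := T) (δ := δ)
      hΘ hconv hne).comp h2
    have h4 : Measurable fun p :
        ((EuclideanSpace ℝ (Fin d) × ℕ) × EuclideanSpace ℝ (Fin d)) × ℕ =>
        probe Θ γ₀ L T δ p.1.1.1 p.1.1.2 p.1.2 p.2 :=
      measurable_from_prod_countable_left fun k => measurable_probe hΘ hconv hne k
    exact (h4.comp (h2.prodMk h3)).prodMk h3

end Measurability

/-! ### A maximal inequality for sums of conditionally sub-Gaussian variables -/

section Maximal

variable {Ω : Type*} {mΩ : MeasurableSpace Ω} {P : Measure Ω}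

/-- Ville's maximal inequality for nonnegative supermartingales up to time `T`, the supermartingale
property being expressed by integrals over the events of the past. -/
theorem mul_measure_exists_le_le_one [IsProbabilityMeasure P] {𝓕 : Filtration ℕ mΩ} {T : ℕ}
    {Z : ℕ → Ω → ENNReal} (hZ : ∀ t ≤ T, Measurable[𝓕 t] (Z t)) (h0 : ∫⁻ ω, Z 0 ω ∂P ≤ 1)
    (hstep : ∀ t < T, ∀ A, MeasurableSet[𝓕 t] A →
      ∫⁻ ω in A, Z (t + 1) ω ∂P ≤ ∫⁻ ω in A, Z t ω ∂P) (c : ENNReal) :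
    c * P {ω | ∃ t ≤ T, c ≤ Z t ω} ≤ 1 := by
  set A : ℕ → Set Ω := fun t => {ω | ∃ s ≤ t, c ≤ Z s ω} with hA
  have hB : ∀ t ≤ T, MeasurableSet[𝓕 t] {ω | c ≤ Z t ω} := fun t ht =>
    hZ t ht measurableSet_Ici
  have hAs : ∀ t, A (t + 1) = A t ∪ {ω | c ≤ Z (t + 1) ω} := by
    intro t
    ext ω
    simp only [hA, Set.mem_ofPred_eq, Set.mem_union, Nat.le_succ_iff, or_and_right, exists_or,
      exists_eq_left]
  have hA0 : A 0 = {ω | c ≤ Z 0 ω} := by simp [hA]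
  have hAm : ∀ t ≤ T, MeasurableSet[𝓕 t] (A t) := by
    intro t
    induction t with
    | zero =>
      intro ht
      rw [hA0]
      exact hB 0 ht
    | succ t ih =>
      intro ht
      rw [hAs]
      exact (𝓕.mono (Nat.le_succ t) _ (ih (by omega))).union (hB (t + 1) ht)
  have hsplit : ∀ t ≤ T, ∀ E : Set Ω, MeasurableSet E →
      c * P (E ∩ {ω | c ≤ Z t ω}) + ∫⁻ ω in E \ {ω | c ≤ Z t ω}, Z t ω ∂P ≤
        ∫⁻ ω in E, Z t ω ∂P := by
    intro t ht E hE
    have hBm := 𝓕.le t _ (hB t ht)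
    rw [← lintegral_inter_add_sdiff (Z t) E hBm]
    gcongr
    rw [← setLIntegral_const]
    exact setLIntegral_mono' (hE.inter hBm) fun ω hω => hω.2
  have main : ∀ t ≤ T, c * P (A t) + ∫⁻ ω in (A t)ᶜ, Z t ω ∂P ≤ 1 := by
    intro t
    induction t with
    | zero =>
      intro ht
      have := hsplit 0 ht Set.univ MeasurableSet.univ
      rw [Set.univ_inter, ← Set.compl_eq_univ_sdiff, setLIntegral_univ, ← hA0] at this
      exact this.trans h0
    | succ t ih =>
      intro ht
      have hAt := hAm t (by omega)
      have h1 := hsplit (t + 1) ht (A t)ᶜ (𝓕.le t _ hAt).compl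
      have h2 : (A (t + 1))ᶜ = (A t)ᶜ \ {ω | c ≤ Z (t + 1) ω} := by
        rw [hAs, Set.compl_union, Set.sdiff_eq]
      have h3 : P (A (t + 1)) ≤ P (A t) + P ((A t)ᶜ ∩ {ω | c ≤ Z (t + 1) ω}) := by
        refine (measure_mono ?_).trans (measure_union_le _ _)
        rw [hAs]
        intro ω hω
        by_cases h : ω ∈ A t
        · exact Or.inl h
        · exact Or.inr ⟨h, hω.resolve_left h⟩
      calc c * P (A (t + 1)) + ∫⁻ ω in (A (t + 1))ᶜ, Z (t + 1) ω ∂P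
          ≤ c * (P (A t) + P ((A t)ᶜ ∩ {ω | c ≤ Z (t + 1) ω}))
            + ∫⁻ ω in (A (t + 1))ᶜ, Z (t + 1) ω ∂P := by gcongr
        _ = c * P (A t) + (c * P ((A t)ᶜ ∩ {ω | c ≤ Z (t + 1) ω})
            + ∫⁻ ω in (A t)ᶜ \ {ω | c ≤ Z (t + 1) ω}, Z (t + 1) ω ∂P) := by
          rw [h2, mul_add, add_assoc]
        _ ≤ c * P (A t) + ∫⁻ ω in (A t)ᶜ, Z t ω ∂P := by
          gcongr
          exact h1.trans (hstep t (by omega) _ hAt.compl)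
        _ ≤ 1 := ih (by omega)
  exact le_self_add.trans (main T le_rfl)

/-- The maximal form of the Azuma–Hoeffding inequality. The variables `X t` are conditionally
sub-Gaussian with variance proxy `R ^ 2`, which is expressed by testing against nonnegative
variables of the past. -/
theorem measure_exists_le_sum_le [IsProbabilityMeasure P] {𝓕 : Filtration ℕ mΩ} {T : ℕ}
    (hT : 1 ≤ T) {X : ℕ → Ω → ℝ} (hX : ∀ t < T, Measurable[𝓕 (t + 1)] (X t)) {R : ℝ} (hR : 0 < R)
    (hsub : ∀ t < T, ∀ θ : ℝ, ∀ W : Ω → ENNReal, Measurable[𝓕 t] W →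
      ∫⁻ ω, W ω * ENNReal.ofReal (Real.exp (θ * X t ω)) ∂P ≤
        ENNReal.ofReal (Real.exp (θ ^ 2 * R ^ 2 / 2)) * ∫⁻ ω, W ω ∂P) {a : ℝ} (ha : 0 < a) :
    P {ω | ∃ t ≤ T, a ≤ ∑ s ∈ Finset.range t, X s ω} ≤
      ENNReal.ofReal (Real.exp (-(a ^ 2 / (2 * (T * R ^ 2))))) := by
  have hT0 : (0 : ℝ) < T := by exact_mod_cast hT
  -- the optimal exponent
  set θ := a / (T * R ^ 2) with hθ
  have hθ0 : 0 < θ := by positivity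
  set b := θ ^ 2 * R ^ 2 / 2 with hb
  have hb0 : 0 ≤ b := by positivity
  set Z : ℕ → Ω → ENNReal := fun t ω =>
    ENNReal.ofReal (Real.exp (θ * ∑ s ∈ Finset.range t, X s ω - t * b)) with hZ
  have hSm : ∀ t ≤ T, Measurable[𝓕 t] fun ω => ∑ s ∈ Finset.range t, X s ω := by
    intro t ht
    refine Finset.measurable_sum _ fun s hs => ?_
    have hs := Finset.mem_range.1 hs
    exact (hX s (by omega)).mono (𝓕.mono (by omega)) le_rfl
  have hZm : ∀ t ≤ T, Measurable[𝓕 t] (Z t) := fun t ht =>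
    ENNReal.measurable_ofReal.comp
      (Real.measurable_exp.comp (((hSm t ht).const_mul θ).sub_const _))
  have hZs : ∀ t ω, Z (t + 1) ω =
      Z t ω * ENNReal.ofReal (Real.exp (θ * X t ω)) * ENNReal.ofReal (Real.exp (-b)) := by
    intro t ω
    simp only [hZ]
    rw [← ENNReal.ofReal_mul (Real.exp_nonneg _), ← ENNReal.ofReal_mul (by positivity),
      ← Real.exp_add, ← Real.exp_add, Finset.sum_range_succ]
    congr 2
    push_cast
    ring
  have hstep : ∀ t < T, ∀ A, MeasurableSet[𝓕 t] A →
      ∫⁻ ω in A, Z (t + 1) ω ∂P ≤ ∫⁻ ω in A, Z t ω ∂P := by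
    intro t ht A hA
    have hA' := 𝓕.le t _ hA
    have hW : Measurable[𝓕 t] (A.indicator (Z t)) := (hZm t ht.le).indicator hA
    have h1 := hsub t ht θ _ hW
    rw [← lintegral_indicator hA', ← lintegral_indicator hA']
    calc ∫⁻ ω, A.indicator (Z (t + 1)) ω ∂P
        = ∫⁻ ω, A.indicator (Z t) ω * ENNReal.ofReal (Real.exp (θ * X t ω)) *
            ENNReal.ofReal (Real.exp (-b)) ∂P := by
          refine lintegral_congr fun ω => ?_
          by_cases hω : ω ∈ A <;> simp [hω, hZs]
      _ = (∫⁻ ω, A.indicator (Z t) ω * ENNReal.ofReal (Real.exp (θ * X t ω)) ∂P) *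
            ENNReal.ofReal (Real.exp (-b)) := lintegral_mul_const' _ _ ENNReal.ofReal_ne_top
      _ ≤ (ENNReal.ofReal (Real.exp b) * ∫⁻ ω, A.indicator (Z t) ω ∂P) *
            ENNReal.ofReal (Real.exp (-b)) := by gcongr
      _ = ∫⁻ ω, A.indicator (Z t) ω ∂P := by
          rw [mul_right_comm, ← ENNReal.ofReal_mul (Real.exp_nonneg _), ← Real.exp_add,
            add_neg_cancel, Real.exp_zero, ENNReal.ofReal_one, one_mul]
  have h0 : ∫⁻ ω, Z 0 ω ∂P ≤ 1 := by simp [hZ]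
  have hmax := mul_measure_exists_le_le_one hZm h0 hstep
    (ENNReal.ofReal (Real.exp (a ^ 2 / (2 * (T * R ^ 2)))))
  have hsubset : {ω | ∃ t ≤ T, a ≤ ∑ s ∈ Finset.range t, X s ω} ⊆
      {ω | ∃ t ≤ T, ENNReal.ofReal (Real.exp (a ^ 2 / (2 * (T * R ^ 2)))) ≤ Z t ω} := by
    rintro ω ⟨t, ht, hat⟩
    refine ⟨t, ht, ENNReal.ofReal_le_ofReal (Real.exp_le_exp.2 ?_)⟩
    have h1 : (t : ℝ) ≤ T := by exact_mod_cast ht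
    calc a ^ 2 / (2 * (T * R ^ 2)) = θ * a - T * b := by rw [hb, hθ]; field_simp; ring
      _ ≤ θ * ∑ s ∈ Finset.range t, X s ω - t * b := by gcongr
  rw [Real.exp_neg, ENNReal.ofReal_inv_of_pos (Real.exp_pos _), ENNReal.le_inv_iff_mul_le, mul_comm]
  exact (mul_le_mul_right (measure_mono hsubset) _).trans hmax

end Maximal

/-! ### The noise of the objective -/

section Noise

/-- Fubini's theorem for an independent pair, with one variable measurable with respect to a
sub-σ-algebra that is independent of the other. -/
lemma lintegral_comp_prodMk_of_indep {Ω Ξ α : Type*} {m mΩ : MeasurableSpace Ω}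
    {mΞ : MeasurableSpace Ξ} [MeasurableSpace α] {P : Measure Ω} [IsProbabilityMeasure P]
    (hm : m ≤ mΩ) {Y : Ω → α} (hY : Measurable[m] Y) {ξ : Ω → Ξ} (hξ : Measurable ξ)
    (hind : Indep (mΞ.comap ξ) m P) {Φ : α × Ξ → ENNReal} (hΦ : Measurable Φ) :
    ∫⁻ ω, Φ (Y ω, ξ ω) ∂P = ∫⁻ ω, ∫⁻ s, Φ (Y ω, s) ∂(P.map ξ) ∂P := by
  have hY' : Measurable Y := hY.mono hm le_rfl
  have : IsProbabilityMeasure (P.map ξ) := Measure.isProbabilityMeasure_map hξ.aemeasurable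
  have hI : IndepFun Y ξ P :=
    (IndepFun_iff_Indep _ _ _).2 (indep_of_indep_of_le_left hind.symm hY.comap_le)
  rw [← lintegral_map (f := Φ) hΦ (hY'.prodMk hξ),
    (indepFun_iff_map_prod_eq_prod_map_map hY'.aemeasurable hξ.aemeasurable).1 hI,
    lintegral_prod _ hΦ.aemeasurable, lintegral_map hΦ.lintegral_prod_right' hY']

variable {d : ℕ} {Ξ : Type*} [mΞ : MeasurableSpace Ξ] {ν : Measure Ξ}
  {𝒟 : Set (EuclideanSpace ℝ (Fin d))} {F : EuclideanSpace ℝ (Fin d) → Ξ → ℝ} {L : ℝ≥0}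

/-- A random function that is almost surely Lipschitz on `𝒟`, and a.e.-measurable at each point of
`𝒟`, has a version on `𝒟` that is surely Lipschitz and jointly measurable. -/
lemma exists_measurable_lipschitz_version (hF : ∀ x ∈ 𝒟, AEMeasurable (F x) ν)
    (hLip : ∀ᵐ s ∂ν, LipschitzOnWith L (fun x => F x s) 𝒟) (hne : 𝒟.Nonempty) :
    ∃ G : 𝒟 → Ξ → ℝ, Measurable (Function.uncurry G) ∧
      (∀ s, LipschitzWith L fun x => G x s) ∧ ∀ᵐ s ∂ν, ∀ x : 𝒟, G x s = F x s := by
  have : Nonempty 𝒟 := hne.to_subtype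
  set q : ℕ → 𝒟 := TopologicalSpace.denseSeq 𝒟
  have hq : DenseRange q := TopologicalSpace.denseRange_denseSeq 𝒟
  have hae : ∀ᵐ s ∂ν, LipschitzOnWith L (fun x => F x s) 𝒟 ∧
      ∀ n, F (q n) s = (hF (q n) (q n).2).mk _ s :=
    hLip.and (ae_all_iff.2 fun n => (hF (q n) (q n).2).ae_eq_mk)
  obtain ⟨N, hNsub, hNm, hN0⟩ := exists_measurable_superset_of_null (ae_iff.1 hae)
  have hNs : ∀ s ∉ N, LipschitzOnWith L (fun x => F x s) 𝒟 ∧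
      ∀ n, F (q n) s = (hF (q n) (q n).2).mk _ s := fun s hs => by
    by_contra hcon
    exact hs (hNsub hcon)
  have hGlip : ∀ s, LipschitzWith L fun x : 𝒟 => Nᶜ.indicator (F x) s := by
    intro s
    by_cases hs : s ∈ N
    · simpa [hs] using (LipschitzWith.const (0 : ℝ)).weaken (zero_le (a := L))
    · have h : (fun x : 𝒟 => Nᶜ.indicator (F x) s) = 𝒟.domRestrict fun x => F x s := by
        ext x
        simp [hs]
      rw [h]
      exact lipschitzOnWith_iff_restrict.1 (hNs s hs).1
  refine ⟨fun x => Nᶜ.indicator (F x), ?_, hGlip, ?_⟩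
  · refine measurable_uncurry_of_continuous_of_measurable (fun s => (hGlip s).continuous)
      fun x => ?_
    have hqm : ∀ n, Measurable (Nᶜ.indicator (F (q n))) := by
      intro n
      have : Nᶜ.indicator (F (q n)) = Nᶜ.indicator ((hF (q n) (q n).2).mk _) :=
        Set.indicator_congr fun s hs => (hNs s hs).2 n
      rw [this]
      exact (hF (q n) (q n).2).measurable_mk.indicator hNm.compl
    have hcl : x ∈ closure (Set.range q) := hq x
    obtain ⟨u, hu, hux⟩ := mem_closure_iff_seq_limit.1 hcl
    choose n hn using hu
    refine measurable_of_tendsto_metrizable (f := fun i => Nᶜ.indicator (F (q (n i))))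
      (fun i => hqm (n i)) (tendsto_pi_nhds.2 fun s => ?_)
    simp only [hn]
    exact ((hGlip s).continuous.tendsto x).comp hux
  · have : ∀ᵐ s ∂ν, s ∉ N := measure_eq_zero_iff_ae_notMem.1 hN0
    filter_upwards [this] with s hs x
    simp [hs]

/-- **Hoeffding's lemma** for the centred difference of two values of a random Lipschitz
function. -/
lemma lintegral_exp_noise_le [IsProbabilityMeasure ν] {G : 𝒟 → Ξ → ℝ}
    (hGm : Measurable (Function.uncurry G)) (hG : ∀ s, LipschitzWith L fun x => G x s)
    (hint : ∀ x, Integrable (G x) ν) {x y : 𝒟} {ρ : ℝ}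
    (hxy : ‖(x : EuclideanSpace ℝ (Fin d)) - y‖ ≤ ρ) (θ : ℝ) :
    ∫⁻ s, ENNReal.ofReal (Real.exp
      (θ * (((∫ r, G x r ∂ν) - ∫ r, G y r ∂ν) - (G x s - G y s)))) ∂ν ≤
      ENNReal.ofReal (Real.exp (θ ^ 2 * (L * ρ) ^ 2 / 2)) := by
  have hρ : 0 ≤ L * ρ := mul_nonneg L.2 ((norm_nonneg _).trans hxy)
  have hm : ∀ x, Measurable (G x) := fun x => hGm.of_uncurry_left
  have hX : ∀ s, G y s - G x s ∈ Set.Icc (-(L * ρ)) (L * ρ) := by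
    intro s
    rw [Set.mem_Icc, ← abs_le, abs_sub_comm, ← Real.dist_eq]
    refine ((hG s).dist_le_mul x y).trans ?_
    rw [Subtype.dist_eq, dist_eq_norm]
    gcongr
  have h := hasSubgaussianMGF_of_mem_Icc (((hm y).sub (hm x)).aemeasurable (μ := ν))
    (Filter.Eventually.of_forall hX)
  have h1 := h.mgf_le θ
  have h2 := h.integrable_exp_mul θ
  rw [mgf] at h1
  have h3 : ∀ s, θ * (((∫ r, G x r ∂ν) - ∫ r, G y r ∂ν) - (G x s - G y s)) =
      θ * ((G y - G x) s - ∫ r, (G y - G x) r ∂ν) := by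
    intro s
    simp only [Pi.sub_apply]
    rw [integral_sub (hint y) (hint x)]
    ring
  simp only [h3]
  rw [← ofReal_integral_eq_lintegral_ofReal h2 (Filter.Eventually.of_forall fun _ => by positivity)]
  refine ENNReal.ofReal_le_ofReal (h1.trans_eq ?_)
  congr 1
  have h4 : ((‖L * ρ - -(L * ρ)‖₊ / 2 : ℝ≥0) : ℝ) = L * ρ := by
    rw [NNReal.coe_div, coe_nnnorm, Real.norm_of_nonneg (by linarith)]
    push_cast
    ring
  rw [NNReal.coe_pow, h4]
  ring

/-- The maximal Azuma–Hoeffding inequality for functions of an adapted sequence `Y` and of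
independent samples, sub-Gaussian in the sample for each value of `Y`. -/
theorem measure_exists_le_sum_comp_le {Ω α : Type*} {mΩ : MeasurableSpace Ω} [MeasurableSpace α]
    {P : Measure Ω} [IsProbabilityMeasure P] {T : ℕ} (hT : 1 ≤ T) {𝓕 : Filtration ℕ mΩ}
    {ξ : ℕ → Ω → Ξ} (hξ : ∀ t ∈ Finset.Icc 1 T, Measurable[𝓕 t] (ξ t))
    (hlaw : ∀ t ∈ Finset.Icc 1 T, P.map (ξ t) = ν)
    (hindep : ∀ t ∈ Finset.Icc 1 T, Indep (mΞ.comap (ξ t)) (𝓕 (t - 1)) P)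
    {Y : ℕ → Ω → α} (hY : ∀ t < T, Measurable[𝓕 t] (Y t)) {ψ : α × Ξ → ℝ} (hψ : Measurable ψ)
    {R : ℝ} (hR : 0 < R) (hψexp : ∀ p θ, ∫⁻ s, ENNReal.ofReal (Real.exp (θ * ψ (p, s))) ∂ν ≤
      ENNReal.ofReal (Real.exp (θ ^ 2 * R ^ 2 / 2))) {a : ℝ} (ha : 0 < a) :
    P {ω | ∃ t ≤ T, a ≤ ∑ s ∈ Finset.range t, ψ (Y s ω, ξ (s + 1) ω)} ≤
      ENNReal.ofReal (Real.exp (-(a ^ 2 / (2 * (T * R ^ 2))))) := by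
  refine measure_exists_le_sum_le (𝓕 := 𝓕) (X := fun t ω => ψ (Y t ω, ξ (t + 1) ω)) hT ?_ hR ?_ ha
  · intro t ht
    exact hψ.comp (((hY t ht).mono (𝓕.mono (Nat.le_succ t)) le_rfl).prodMk
      (hξ (t + 1) (Finset.mem_Icc.2 ⟨by omega, ht⟩)))
  · intro t ht θ W hW
    have hmem : t + 1 ∈ Finset.Icc 1 T := Finset.mem_Icc.2 ⟨by omega, ht⟩
    have hexp : Measurable fun p : α × Ξ => ENNReal.ofReal (Real.exp (θ * ψ p)) :=
      ENNReal.measurable_ofReal.comp (Real.measurable_exp.comp (hψ.const_mul θ))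
    have hΦ : Measurable fun p : (ENNReal × α) × Ξ =>
        p.1.1 * ENNReal.ofReal (Real.exp (θ * ψ (p.1.2, p.2))) :=
      measurable_fst.fst.mul (hexp.comp (measurable_fst.snd.prodMk measurable_snd))
    have h := lintegral_comp_prodMk_of_indep (𝓕.le t) (hW.prodMk (hY t ht))
      ((hξ _ hmem).mono (𝓕.le _) le_rfl) (hindep _ hmem) hΦ
    rw [hlaw _ hmem] at h
    rw [h, ← lintegral_const_mul' _ _ ENNReal.ofReal_ne_top]
    refine lintegral_mono fun ω => ?_
    have hm : Measurable fun s => ENNReal.ofReal (Real.exp (θ * ψ (Y t ω, s))) :=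
      hexp.comp measurable_prodMk_left
    change ∫⁻ s, W ω * ENNReal.ofReal (Real.exp (θ * ψ (Y t ω, s))) ∂ν ≤ _
    rw [lintegral_const_mul _ hm, mul_comm]
    gcongr
    exact hψexp _ θ

open scoped Classical in
/-- The maximal Azuma–Hoeffding inequality for the noise of the objective along an adapted
sequence `Y` of states, when only the states in a set `B` within distance `ρ` of `y` count. -/
theorem measure_exists_le_noise_le {Ω : Type*} {mΩ : MeasurableSpace Ω} {P : Measure Ω}
    [IsProbabilityMeasure P] [IsProbabilityMeasure ν] {G : 𝒟 → Ξ → ℝ}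
    (hGm : Measurable (Function.uncurry G)) (hG : ∀ s, LipschitzWith L fun x => G x s)
    (hint : ∀ x, Integrable (G x) ν) {T : ℕ} (hT : 1 ≤ T) {𝓕 : Filtration ℕ mΩ}
    {ξ : ℕ → Ω → Ξ} (hξ : ∀ t ∈ Finset.Icc 1 T, Measurable[𝓕 t] (ξ t))
    (hlaw : ∀ t ∈ Finset.Icc 1 T, P.map (ξ t) = ν)
    (hindep : ∀ t ∈ Finset.Icc 1 T, Indep (mΞ.comap (ξ t)) (𝓕 (t - 1)) P)
    {Y : ℕ → Ω → 𝒟 × ℕ} (hY : ∀ t < T, Measurable[𝓕 t] (Y t)) (y : 𝒟) {ρ : ℝ}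
    (hLρ : 0 < L * ρ) {B : Set (EuclideanSpace ℝ (Fin d) × ℕ)} (hB : MeasurableSet B)
    (hBρ : ∀ p ∈ B, ‖p.1 - y‖ ≤ ρ) {a : ℝ} (ha : 0 < a) :
    P {ω | ∃ t ≤ T, a ≤ ∑ s ∈ Finset.range t,
      if (((Y s ω).1 : EuclideanSpace ℝ (Fin d)), (Y s ω).2) ∈ B then
        ((∫ r, G (Y s ω).1 r ∂ν) - ∫ r, G y r ∂ν) -
          (G (Y s ω).1 (ξ (s + 1) ω) - G y (ξ (s + 1) ω)) else 0} ≤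
      ENNReal.ofReal (Real.exp (-(a ^ 2 / (2 * (T * (L * ρ) ^ 2))))) := by
  set ψ : (𝒟 × ℕ) × Ξ → ℝ := fun p =>
    if ((p.1.1 : EuclideanSpace ℝ (Fin d)), p.1.2) ∈ B then
      ((∫ r, G p.1.1 r ∂ν) - ∫ r, G y r ∂ν) - (G p.1.1 p.2 - G y p.2) else 0 with hψ
  have hψm : Measurable ψ := by
    have h1 : Measurable fun x : 𝒟 => ∫ r, G x r ∂ν :=
      hGm.stronglyMeasurable.integral_prod_right.measurable
    have h2 : Measurable fun p : (𝒟 × ℕ) × Ξ => G y p.2 := hGm.of_uncurry_left.comp measurable_snd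
    have h3 : Measurable fun p : (𝒟 × ℕ) × Ξ => p.1.1 := measurable_fst.fst
    have h4 : Measurable fun p : (𝒟 × ℕ) × Ξ => G p.1.1 p.2 := hGm.comp (h3.prodMk measurable_snd)
    have h5 : Measurable fun p : (𝒟 × ℕ) × Ξ => ((p.1.1 : EuclideanSpace ℝ (Fin d)), p.1.2) :=
      (measurable_subtype_coe.comp h3).prodMk measurable_fst.snd
    have h6 : Measurable fun p : (𝒟 × ℕ) × Ξ => ∫ r, G p.1.1 r ∂ν := h1.comp h3
    exact Measurable.ite (h5 hB) ((h6.sub_const _).sub (h4.sub h2)) measurable_const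
  have hψexp : ∀ (p : 𝒟 × ℕ) (θ : ℝ), ∫⁻ s, ENNReal.ofReal (Real.exp (θ * ψ (p, s))) ∂ν ≤
      ENNReal.ofReal (Real.exp (θ ^ 2 * (L * ρ) ^ 2 / 2)) := by
    intro p θ
    by_cases hp : ((p.1 : EuclideanSpace ℝ (Fin d)), p.2) ∈ B
    · simp only [hψ, if_pos hp]
      have hpy : ‖(p.1 : EuclideanSpace ℝ (Fin d)) - y‖ ≤ ρ := hBρ (p.1, p.2) hp
      exact lintegral_exp_noise_le hGm hG hint hpy θ
    · simp only [hψ, if_neg hp, mul_zero, Real.exp_zero, ENNReal.ofReal_one, lintegral_const,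
        measure_univ, one_mul]
      exact ENNReal.one_le_ofReal.2 (Real.one_le_exp (by positivity))
  exact measure_exists_le_sum_comp_le hT hξ hlaw hindep hY hψm hLρ hψexp ha

end Noise

/-! ### Choice of the target index and of the noise level -/

lemma exists_gammaSeq_between {γ₀ D : ℝ} (hγ₀ : 0 < γ₀) (hD : γ₀ ≤ D) :
    ∃ K : ℕ, 1 ≤ K ∧ D ≤ gammaSeq γ₀ K ∧ gammaSeq γ₀ K ≤ 2 * D := by
  have hex : ∃ k : ℕ, D ≤ gammaSeq γ₀ (k + 1) := by
    obtain ⟨n, hn⟩ := pow_unbounded_of_one_lt (D / γ₀) (one_lt_two (α := ℝ))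
    refine ⟨n, ?_⟩
    rw [div_lt_iff₀ hγ₀] at hn
    rw [gammaSeq_succ]
    unfold gammaSeq
    nlinarith
  classical
  refine ⟨Nat.find hex + 1, by omega, Nat.find_spec hex, ?_⟩
  rw [gammaSeq_succ]
  rcases Nat.eq_zero_or_pos (Nat.find hex) with h | h
  · rw [h]
    simpa [gammaSeq] using hD
  · have h1 := Nat.find_min hex (Nat.sub_lt h Nat.one_pos)
    rw [Nat.sub_add_cancel (show 1 ≤ Nat.find hex from h)] at h1
    linarith

lemma le_logb_of_gammaSeq_le {γ₀ D : ℝ} (hγ₀ : 0 < γ₀) {K : ℕ} (h : gammaSeq γ₀ K ≤ 2 * D) :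
    (K : ℝ) ≤ Real.logb 2 (2 * D / γ₀) := by
  have h1 := gammaSeq_pos hγ₀ K
  rw [Real.le_logb_iff_rpow_le (by norm_num) (by have : 0 < 2 * D := by linarith
                                                 positivity),
    Real.rpow_natCast, le_div_iff₀ hγ₀, mul_comm]
  exact h

lemma exp_neg_ell_le {T : ℕ} (hT : 1 ≤ T) {δ : ℝ} (hδ : 0 < δ) : Real.exp (-ell T δ) ≤ δ := by
  have h1 := one_le_logb_two_mul hT
  calc Real.exp (-ell T δ) ≤ Real.exp (-Real.log (Real.logb 2 (2 * (T : ℝ)) / δ)) := by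
        gcongr
        exact le_max_right _ _
    _ = δ / Real.logb 2 (2 * (T : ℝ)) := by
        rw [Real.exp_neg, Real.exp_log (by positivity), inv_div]
    _ ≤ δ := div_le_self hδ.le h1

/-- The Azuma–Hoeffding bound at the level `56 γ h`, for noise cut off at distance `39 γ`: the
constants are such that `56 ^ 2 ≥ 2 * 39 ^ 2`. -/
lemma exp_neg_noise_level_le {L γ : ℝ} (hL : 0 < L) (hγ : 0 < γ) {T : ℕ} (hT : 1 ≤ T) {δ : ℝ}
    (hδ : 0 < δ) {K : ℕ} (hK : 1 ≤ K) :
    Real.exp (-((56 * γ * hSeq L T δ K) ^ 2 / (2 * (T * (L * (39 * γ)) ^ 2)))) ≤ δ / 2 := by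
  have hT0 : (0 : ℝ) < T := by exact_mod_cast hT
  have hK0 : (1 : ℝ) ≤ K := by exact_mod_cast hK
  set l := ell T (δ / (1 + (K : ℝ)) ^ 2) with hl
  have hl1 : 1 ≤ l := one_le_ell _ _
  have h1 : (56 * γ * hSeq L T δ K) ^ 2 / (2 * (T * (L * (39 * γ)) ^ 2)) = 3136 / 3042 * l := by
    have : hSeq L T δ K ^ 2 = L ^ 2 * (T * l) := by
      unfold hSeq
      rw [mul_pow, Real.sq_sqrt (by positivity)]
    rw [mul_pow, this]
    field_simp
    norm_num
  rw [h1]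
  calc Real.exp (-(3136 / 3042 * l)) ≤ Real.exp (-l) := by
        gcongr
        linarith
    _ ≤ δ / (1 + (K : ℝ)) ^ 2 := exp_neg_ell_le hT (by positivity)
    _ ≤ δ / 2 := by
        gcongr
        nlinarith

/-! ### The regret bound -/

theorem mainTheorem3 {d : ℕ} {Ω Ξ : Type*} [mΩ : MeasurableSpace Ω] [mΞ : MeasurableSpace Ξ]
    (P : Measure Ω) [IsProbabilityMeasure P] (ν : Measure Ξ) [IsProbabilityMeasure ν]
    -- the domain, the constraint set and the random function
    (Θ 𝒟 : Set (EuclideanSpace ℝ (Fin d)))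
    (hΘ : IsClosed Θ) (hΘconv : Convex ℝ Θ) (h𝒟 : IsOpen 𝒟) (hΘ𝒟 : Θ ⊆ 𝒟)
    (F : EuclideanSpace ℝ (Fin d) → Ξ → ℝ)
    (hint : ∀ x ∈ 𝒟, Integrable (F x) ν)
    (hconv : ConvexOn ℝ Θ (expectedObjective F ν))
    (xs : EuclideanSpace ℝ (Fin d)) (hxs : xs ∈ Θ) (hmin : IsMinOn (expectedObjective F ν) Θ xs)
    (L : ℝ≥0) (hL : 0 < L) (hLip : ∀ᵐ s ∂ν, LipschitzOnWith L (fun x => F x s) 𝒟)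
    -- the inputs of the algorithm
    (x₁ : EuclideanSpace ℝ (Fin d)) (hx₁ : x₁ ∈ 𝒟) (γ₀ : ℝ) (hγ₀ : 0 < γ₀)
    (T : ℕ) (hT : 1 ≤ T) (δ : ℝ) (hδ : 0 < δ)
    -- the i.i.d. samples `ξ t` (with law `ν`) and the stochastic subgradients `g t`
    (𝓕 : Filtration ℕ mΩ) (ξ : ℕ → Ω → Ξ) (g : ℕ → Ω → EuclideanSpace ℝ (Fin d))
    (hξ : ∀ t ∈ Finset.Icc 1 T, Measurable[𝓕 t] (ξ t))
    (hlaw : ∀ t ∈ Finset.Icc 1 T, P.map (ξ t) = ν)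
    (hindep : ∀ t ∈ Finset.Icc 1 T, Indep (mΞ.comap (ξ t)) (𝓕 (t - 1)) P)
    (hg : ∀ t ∈ Finset.Icc 1 T, Measurable[𝓕 t] (g t))
    (hsub : ∀ t ∈ Finset.Icc 1 T, ∀ᵐ ω ∂P,
      g t ω ∈ subdiff Θ (fun x => F x (ξ t ω))
        (algIterate Θ x₁ γ₀ L T δ (fun s => g s ω) t)) :
    let f := expectedObjective F ν
    let D := max ‖x₁ - xs‖ γ₀
    ENNReal.ofReal (1 - δ) ≤
      P {ω | ∑ t ∈ Finset.Icc 1 T, (f (algIterate Θ x₁ γ₀ L T δ (fun s => g s ω) t) - f xs) ≤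
        3500 * D * L * √(T : ℝ) * Real.logb 2 (2 * D / γ₀) *
          √(ell T (δ / (Real.logb 2 (4 * D / γ₀)) ^ 2))} := by
  intro f D
  classical
  have hne : Θ.Nonempty := ⟨xs, hxs⟩
  have hL0 : (0 : ℝ) < L := hL
  have hcD : ‖x₁ - xs‖ ≤ D := le_max_left _ _
  have hγD : γ₀ ≤ D := le_max_right _ _
  have hD0 : 0 < D := hγ₀.trans_le hγD
  obtain ⟨K, hK, hDK, hKD⟩ := exists_gammaSeq_between hγ₀ hγD
  have hKlog := le_logb_of_gammaSeq_le hγ₀ hKD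
  set γ := gammaSeq γ₀ K with hγ
  have hγ0 : 0 < γ := gammaSeq_pos hγ₀ K
  set h := hSeq L T δ K with hh
  have hh0 : 0 < h := hL0.trans_le (le_hSeq hL0.le hT δ K)
  set H := L * √(T : ℝ) * √(ell T (δ / (Real.logb 2 (4 * D / γ₀)) ^ 2)) with hH
  have hhH : h ≤ H := by
    have h1 : Real.logb 2 (4 * D / γ₀) = 1 + Real.logb 2 (2 * D / γ₀) := by
      rw [show 4 * D / γ₀ = 2 * (2 * D / γ₀) by ring, Real.logb_mul (by norm_num) (by positivity),
        Real.logb_self_eq_one (by norm_num)]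
    have h2 : ell T (δ / (1 + (K : ℝ)) ^ 2) ≤ ell T (δ / (Real.logb 2 (4 * D / γ₀)) ^ 2) := by
      have h3 : (0 : ℝ) ≤ K := Nat.cast_nonneg K
      have h4 : (1 : ℝ) + K ≤ Real.logb 2 (4 * D / γ₀) := by linarith
      have h5 : 0 < Real.logb 2 (4 * D / γ₀) := by linarith
      exact ell_le_ell hT (by positivity) (by gcongr)
    rw [hh, hH, hSeq, mul_assoc, Real.sqrt_mul (by positivity)]
    gcongr
  -- the jointly measurable version of the random function and the adapted states
  obtain ⟨G, hGm, hG, hGF⟩ := exists_measurable_lipschitz_version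
    (fun x hx => (hint x hx).aemeasurable) hLip ⟨x₁, hx₁⟩
  have hGF' : ∀ x : 𝒟, G x =ᵐ[ν] F x := fun x => hGF.mono fun s hs => hs x
  have hGint : ∀ x, Integrable (G x) ν := fun x => (hint x x.2).congr (hGF' x).symm
  have hGf : ∀ x : 𝒟, ∫ r, G x r ∂ν = f x := fun x => integral_congr_ae (hGF' x)
  have hmem : ∀ t ω, (algState Θ x₁ γ₀ L T δ (fun s => g s ω) t).1 ∈ 𝒟 := by
    intro t ω
    rcases eq_or_ne t 0 with rfl | ht
    · exact hx₁
    · exact hΘ𝒟 (algState_fst_mem hΘ hΘconv hne x₁ γ₀ L T δ _ ht)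
  set Y : ℕ → Ω → 𝒟 × ℕ := fun t ω =>
    (⟨(algState Θ x₁ γ₀ L T δ (fun s => g s ω) t).1, hmem t ω⟩,
      (algState Θ x₁ γ₀ L T δ (fun s => g s ω) t).2) with hY
  have hYm : ∀ t < T, Measurable[𝓕 t] (Y t) := by
    intro t ht
    have h1 := measurable_algState (x₁ := x₁) (γ₀ := γ₀) (L := L) (δ := δ) hΘ hΘconv hne hg t ht.le
    exact (measurable_fst.comp h1).subtype_mk.prodMk (measurable_snd.comp h1)
  set ys : 𝒟 := ⟨xs, hΘ𝒟 hxs⟩ with hys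
  -- the noise of round `t + 1`, and its sums over a set of states
  set Δ : ℕ → Ω → ℝ := fun t ω => (G (Y t ω).1 (ξ (t + 1) ω) - G ys (ξ (t + 1) ω)) -
    (f (Y t ω).1 - f xs) with hΔ
  set N : Set (EuclideanSpace ℝ (Fin d) × ℕ) → ℕ → Ω → ℝ := fun B t ω =>
    ∑ s ∈ Finset.range t,
      if algState Θ x₁ γ₀ L T δ (fun s => g s ω) s ∈ B then Δ s ω else 0 with hN
  set E : Set (EuclideanSpace ℝ (Fin d) × ℕ) → Set Ω := fun B =>
    {ω | ∃ t ≤ T, 56 * γ * h ≤ -N B t ω} with hE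
  have hEle : ∀ B, MeasurableSet B → (∀ p ∈ B, ‖p.1 - xs‖ ≤ 39 * γ) →
      P (E B) ≤ ENNReal.ofReal (δ / 2) := by
    intro B hB hBρ
    have h1 := measure_exists_le_noise_le hGm hG hGint hT hξ hlaw hindep hYm ys
      (ρ := 39 * γ) (by positivity) hB hBρ (a := 56 * γ * h) (by positivity)
    refine (measure_mono ?_).trans
      (h1.trans (ENNReal.ofReal_le_ofReal (exp_neg_noise_level_le hL0 hγ0 hT hδ hK)))
    rintro ω ⟨t, ht, hω⟩
    refine ⟨t, ht, hω.trans_eq ?_⟩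
    rw [hN, ← Finset.sum_neg_distrib]
    refine Finset.sum_congr rfl fun s _ => ?_
    rw [hGf, hGf]
    by_cases hs : algState Θ x₁ γ₀ L T δ (fun s => g s ω) s ∈ B
    · rw [if_pos hs, if_pos hs, hΔ, neg_sub]
    · rw [if_neg hs, if_neg hs, neg_zero]
  have hball : MeasurableSet {p : EuclideanSpace ℝ (Fin d) × ℕ | ‖p.1 - xs‖ ≤ 39 * γ} :=
    measurableSet_le (measurable_fst.sub_const xs).norm measurable_const
  have htgt : MeasurableSet {p : EuclideanSpace ℝ (Fin d) × ℕ | p.2 = K ∧ p.1 ∈ Θ} :=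
    (measurable_snd (measurableSet_singleton K)).inter (measurable_fst hΘ.measurableSet)
  have hE1 := hEle (targetStates Θ xs γ₀ K) (htgt.inter hball) fun p hp => hp.2
  have hE2 := hEle (earlyStates Θ xs γ₀ K) (htgt.compl.inter hball) fun p hp => hp.2
  -- the almost sure properties of the samples and of the subgradients
  have hae : ∀ᵐ ω ∂P, ∀ t < T,
      g (t + 1) ω ∈ subdiff Θ (fun x => F x (ξ (t + 1) ω))
        (algState Θ x₁ γ₀ L T δ (fun s => g s ω) t).1 ∧
      LipschitzOnWith L (fun x => F x (ξ (t + 1) ω)) 𝒟 ∧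
      ∀ x : 𝒟, G x (ξ (t + 1) ω) = F x (ξ (t + 1) ω) := by
    refine ae_all_iff.2 fun t => ?_
    by_cases ht : t < T
    · have hmem : t + 1 ∈ Finset.Icc 1 T := Finset.mem_Icc.2 ⟨by omega, ht⟩
      have h1 : ∀ᵐ s ∂(P.map (ξ (t + 1))), LipschitzOnWith L (fun x => F x s) 𝒟 ∧
          ∀ x : 𝒟, G x s = F x s := by
        rw [hlaw _ hmem]
        exact hLip.and hGF
      filter_upwards [hsub _ hmem,
        ae_of_ae_map ((hξ _ hmem).mono (𝓕.le _) le_rfl).aemeasurable h1] with ω h2 h3 _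
      exact ⟨h2, h3⟩
    · exact Filter.Eventually.of_forall fun ω h => absurd h ht
  have hbad := ae_iff.1 hae
  set bad := {ω | ¬∀ t < T, g (t + 1) ω ∈ subdiff Θ (fun x => F x (ξ (t + 1) ω))
        (algState Θ x₁ γ₀ L T δ (fun s => g s ω) t).1 ∧
      LipschitzOnWith L (fun x => F x (ξ (t + 1) ω)) 𝒟 ∧
      ∀ x : 𝒟, G x (ξ (t + 1) ω) = F x (ξ (t + 1) ω)} with hbaddef
  set good := {ω | ∑ t ∈ Finset.Icc 1 T,
      (f (algIterate Θ x₁ γ₀ L T δ (fun s => g s ω) t) - f xs) ≤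
        3500 * D * L * √(T : ℝ) * Real.logb 2 (2 * D / γ₀) *
          √(ell T (δ / (Real.logb 2 (4 * D / γ₀)) ^ 2))} with hgood
  have hcover : Set.univ ⊆
      good ∪ (bad ∪ (E (targetStates Θ xs γ₀ K) ∪ E (earlyStates Θ xs γ₀ K))) := by
    intro ω _
    by_contra hω
    simp only [Set.mem_union, not_or] at hω
    obtain ⟨hng, hnb, hn1, hn2⟩ := hω
    refine hng ?_
    have hω : ∀ t < T, _ := not_not.1 hnb
    have hn1 : ∀ t ≤ T, -N (targetStates Θ xs γ₀ K) t ω ≤ 56 * γ * h := fun t ht => by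
      by_contra! hlt
      exact hn1 ⟨t, ht, hlt.le⟩
    have hn2 : ∀ t ≤ T, -N (earlyStates Θ xs γ₀ K) t ω ≤ 56 * γ * h := fun t ht => by
      by_contra! hlt
      exact hn2 ⟨t, ht, hlt.le⟩
    set x : ℕ → EuclideanSpace ℝ (Fin d) := fun t =>
      (algState Θ x₁ γ₀ L T δ (fun s => g s ω) t).1 with hx
    have hgL : ∀ t < T, ‖g (t + 1) ω‖ ≤ L := fun t ht =>
      norm_le_of_mem_subdiff h𝒟 (hω t ht).2.1 (hmem t ω) (hω t ht).1
    have hlin : ∀ t < T, (f (x t) - f xs) + Δ t ω ≤ inner ℝ (g (t + 1) ω) (x t - xs) := by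
      intro t ht
      obtain ⟨h1, -, h2⟩ := hω t ht
      have h3 : F (x t) (ξ (t + 1) ω) + inner ℝ (g (t + 1) ω) (xs - x t) ≤
          F xs (ξ (t + 1) ω) := h1.1 xs hxs
      have h4 : inner ℝ (g (t + 1) ω) (xs - x t) = - inner ℝ (g (t + 1) ω) (x t - xs) := by
        rw [← inner_neg_right, neg_sub]
      have h5 : Δ t ω = (F (x t) (ξ (t + 1) ω) - F xs (ξ (t + 1) ω)) - (f (x t) - f xs) := by
        simp only [hΔ, h2]
        rfl
      linarith
    obtain ⟨hpath, hmono⟩ := index_le_of_noise_le (g := fun s => g s ω)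
      (a := fun t => f (x t) - f xs) (Δ := fun t => Δ t ω)
      hΘ hΘconv hxs hγ₀ hL0 hT hK (hcD.trans hDK) hgL
      (fun t _ hxΘ => sub_nonneg.2 (hmin hxΘ)) hlin hn1
    have hreg := sum_inner_le (g := fun s => g s ω) (H := H) hΘ hΘconv hxs hγ₀ hL0 hT hcD hKD
      (fun k hk => (hSeq_le_hSeq hL0.le hT hδ hk).trans hhH) hgL hpath hmono
    -- every state lies in exactly one of the two sets
    have hsplit : ∑ t ∈ Finset.range T, Δ t ω =
        N (targetStates Θ xs γ₀ K) T ω + N (earlyStates Θ xs γ₀ K) T ω := by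
      simp only [hN]
      rw [← Finset.sum_add_distrib]
      refine Finset.sum_congr rfl fun t ht => ?_
      have hd : ‖x t - xs‖ ≤ 39 * γ := by
        obtain ⟨h1, h2⟩ := hpath t (Finset.mem_range.1 ht).le
        have h3 := gammaSeq_mono hγ₀ h1
        have h4 := norm_sub_le_norm_sub_add_norm_sub (x t) x₁ xs
        linarith
      by_cases hI : (algState Θ x₁ γ₀ L T δ (fun s => g s ω) t).2 = K ∧ x t ∈ Θ
      · rw [if_pos ⟨hI, hd⟩, if_neg fun hJ => hJ.1 hI, add_zero]
      · rw [if_neg fun hJ => hI hJ.1, if_pos ⟨hI, hd⟩, zero_add]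
    have hsum : ∑ t ∈ Finset.Icc 1 T,
        (f (algIterate Θ x₁ γ₀ L T δ (fun s => g s ω) t) - f xs) =
        ∑ t ∈ Finset.range T, (f (x t) - f xs) := by
      refine Finset.sum_nbij' (fun t => t - 1) (fun t => t + 1) ?_ ?_ ?_ ?_ ?_
      · intro t ht
        simp only [Finset.mem_Icc, Finset.mem_range] at *
        omega
      · intro t ht
        simp only [Finset.mem_Icc, Finset.mem_range] at *
        omega
      · intro t ht
        simp only [Finset.mem_Icc] at *
        omega
      · intro t _
        rfl
      · intro t _
        rfl
    have htot : ∑ t ∈ Finset.range T, (f (x t) - f xs) + ∑ t ∈ Finset.range T, Δ t ω ≤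
        ∑ t ∈ Finset.range T, inner ℝ (g (t + 1) ω) (x t - xs) := by
      rw [← Finset.sum_add_distrib]
      exact Finset.sum_le_sum fun t ht => hlin t (Finset.mem_range.1 ht)
    have h1 := hn1 T le_rfl
    have h2 := hn2 T le_rfl
    have hH0 : 0 < H := hh0.trans_le hhH
    have h3 : γ * h ≤ 2 * D * H := by gcongr
    have h4 : (1 : ℝ) ≤ K := by exact_mod_cast hK
    have h5 : D * H ≤ D * H * K := le_mul_of_one_le_right (by positivity) h4
    have h6 : D * H * K ≤ D * H * Real.logb 2 (2 * D / γ₀) := by gcongr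
    change ∑ t ∈ Finset.range T, inner ℝ (g (t + 1) ω) (x t - xs) ≤ _ at hreg
    rw [hgood, Set.mem_ofPred_eq, hsum, show 3500 * D * L * √(T : ℝ) * Real.logb 2 (2 * D / γ₀) *
      √(ell T (δ / (Real.logb 2 (4 * D / γ₀)) ^ 2)) =
      3500 * (D * H * Real.logb 2 (2 * D / γ₀)) by rw [hH]; ring]
    have h7 : 0 < D * H := by positivity
    nlinarith
  -- the set in the statement need not be measurable, so subadditivity is used in place of
  -- complements
  have hP : 1 ≤ P good + ENNReal.ofReal δ := by
    calc (1 : ENNReal) = P Set.univ := measure_univ.symm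
      _ ≤ P (good ∪ (bad ∪ (E (targetStates Θ xs γ₀ K) ∪ E (earlyStates Θ xs γ₀ K)))) :=
        measure_mono hcover
      _ ≤ P good + (P bad + (P (E (targetStates Θ xs γ₀ K)) + P (E (earlyStates Θ xs γ₀ K)))) :=
        (measure_union_le _ _).trans (add_le_add le_rfl ((measure_union_le _ _).trans
          (add_le_add le_rfl (measure_union_le _ _))))
      _ ≤ P good + (0 + (ENNReal.ofReal (δ / 2) + ENNReal.ofReal (δ / 2))) := by
        gcongr
        exact hbad.le
      _ = P good + ENNReal.ofReal δ := by
        rw [zero_add, ← ENNReal.ofReal_add (by positivity) (by positivity), add_halves]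
  rw [ENNReal.ofReal_sub _ hδ.le, ENNReal.ofReal_one]
  exact tsub_le_iff_right.2 hP
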